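/- **Setting.** Let $(X,Y)\in\mathbb R^d\times\{0,1\}$ have distribution $\mathbb P$, with marginal $\mathbb P_X$ of $X$ and regression function $\eta(x)=\mathbb P(Y=1\mid X=x)$. For a measurable classifier $g:\mathbb R^d\to\{0,1\}$ put $$F_1(g)=\frac{\mathbb P(Y=1,\,g(X)=1)}{\mathbb P(Y=1)+\mathbb P(g(X)=1)},\qquad \mathcal E_1(g)=\max_{f}F_1(f)-F_1(g),$$ the maximum being over all measurable classifiers $f$. If $\mathbb P(Y=1)>0$, let $\theta^*\in[0,1]$ be the unique solution of $\theta\,\mathbb P(Y=1)=\mathbb E(\eta(X)-\theta)_+$. For positive constants $\alpha,C_0,\delta_0,p,\beta,L,c_0,r_0,\mu_{\min},\mu_{\max}$, let $\mathcal P_\Sigma$ be the class of all distributions $\mathbb P$ on $\mathbb R^d\times\{0,1\}$ such that 1. (margin) $\mathbb P_X(0<|\eta(X)-\theta^*|\le\delta)\le C_0\delta^\alpha$ for all $0<\delta\le\delta_0$; 2. $\mathbb P(Y=1)\ge p$; 3. (Hölder smoothness) $\eta$ has a version $\eta:\mathbb R^d\to[0,1]$ that is $\lfloor\beta\rfloor$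 times continuously differentiable with $|\eta(x')-\eta_x(x')|\le L\|x-x'\|_2^\beta$ for all $x,x'\in\mathbb R^d$, where $\eta_x$ is the Taylor polynomial of $\eta$ at $x$ of degree $\lfloor\beta\rfloor$; 4. (strong density) there is a compact set $A\subset\mathbb R^d$ with $\lambda(A\cap B(x,r))\ge c_0\lambda(B(x,r))$ for all $x\in A$ and $0<r\le r_0$ ($\lambda$ is Lebesgue measure, $B(x,r)$ the Euclidean ball), and $\mathbb P_X$ has a Lebesgue density that takes values in $[\mu_{\min},\mu_{\max}]$ on $A$ and vanishes outside $A$. **Theorem.** Let $d\in\mathbb N$, $\alpha,\beta>0$ with $\alpha\beta\le d$, and let $p\in(0,1)$, $C_0>0$, $\delta_0\in(0,1/12]$, $L>0$ and $0<\mu_{\min}\le\mu_{\max}$ be arbitrary. Then for all sufficiently small $c_0,r_0>0$ (that is, for all $0<c_0\le\bar c$ and $0<r_0\le\bar r$, where $\bar c,\bar r>0$ depend only on the preceding parameters) there is a constant $c>0$, depending only on the parameters of the class and not on $n,N$, such that for all integers $n>1$ and $N>1$ $$\inf_{\hat g}\ \sup_{\mathbb P\in\mathcal P_\Sigma}\ \mathbb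 E_{(\mathcal D_n,\mathcal D_N)}\,\mathcal E_1(\hat g)\ \ge\ c\,n^{-\frac{(1+\alpha)\beta}{2\beta+d}}.$$ Here $\mathcal D_n$ consists of $n$ i.i.d. copies of $(X,Y)\sim\mathbb P$, $\mathcal D_N$ of $N$ further independent copies of $X\sim\mathbb P_X$ (so the expectation is with respect to $\mathbb P^{\otimes n}\otimes\mathbb P_X^{\otimes N}$), and the infimum is over all measurable data-dependent classifiers $\hat g=\hat g(\,\cdot\,;\mathcal D_n,\mathcal D_N):\mathbb R^d\to\{0,1\}$. -/

import Mathlib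

open MeasureTheory
open scoped Nat

noncomputable section

/-- The feature space `ℝ^d` with its Euclidean norm. -/
abbrev Feat (d : ℕ) : Type := EuclideanSpace ℝ (Fin d)

/-- Values of the random couple `(X, Y)`, with label `Y ∈ {0, 1}`. -/
abbrev Obs (d : ℕ) : Type := Feat d × Fin 2

/-- `P(Y = 1)`. -/
def probOne {d : ℕ} (P : Measure (Obs d)) : ℝ := P.real {z | z.2 = 1}

/-- `F_b(g) = P(Y = 1, g(X) = 1) / (b² P(Y = 1) + P(g(X) = 1))`. -/
def fScore {d : ℕ} (b : ℝ) (P : Measure (Obs d)) (g : Feat d → Fin 2) : ℝ :=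
  P.real {z | z.2 = 1 ∧ g z.1 = 1} / (b ^ 2 * probOne P + P.real {z | g z.1 = 1})

/-- The excess score of `g`: the best `F_b`-score over all (measurable) classifiers,
minus the score of `g`. -/
def excessScore {d : ℕ} (b : ℝ) (P : Measure (Obs d)) (g : Feat d → Fin 2) : ℝ :=
  (⨆ f : {f : Feat d → Fin 2 // Measurable f}, fScore b P f.1) - fScore b P g

/-- `η` is a version of the regression function `η(X) = P(Y = 1 | X)`, with values in `[0, 1]`. -/
structure IsRegressionFunction {d : ℕ} (P : Measure (Obs d)) (η : Feat d → ℝ) : Prop where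
  measurable : Measurable η
  mem_Icc : ∀ x, η x ∈ Set.Icc (0 : ℝ) 1
  setIntegral_eq : ∀ s : Set (Feat d), MeasurableSet s →
    ∫ x in s, η x ∂P.fst = P.real {z | z.1 ∈ s ∧ z.2 = 1}

/-- `θ ∈ [0, 1]` is the optimal threshold: the root of `b² θ P(Y = 1) = E (η(X) - θ)₊`
(unique as soon as `P(Y = 1) > 0` and `b > 0`). -/
def IsOptimalThreshold {d : ℕ} (b : ℝ) (P : Measure (Obs d)) (η : Feat d → ℝ) (θ : ℝ) : Prop :=
  θ ∈ Set.Icc (0 : ℝ) 1 ∧ b ^ 2 * θ * probOne P = ∫ x, max (η x - θ) 0 ∂P.fst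

/-- The `α`-margin assumption with constants `C₀, δ₀`, for the `F₁`-score. -/
def MarginAssumption {d : ℕ} (α C₀ δ₀ : ℝ) (P : Measure (Obs d)) (η : Feat d → ℝ) : Prop :=
  ∃ θ : ℝ, IsOptimalThreshold 1 P η θ ∧
    ∀ δ : ℝ, 0 < δ → δ ≤ δ₀ → P.fst.real {x | 0 < |η x - θ| ∧ |η x - θ| ≤ δ} ≤ C₀ * δ ^ α

/-- The Taylor polynomial of degree `k` of `h` at `x`, evaluated at `x'`. -/
def taylorPoly {d : ℕ} (k : ℕ) (h : Feat d → ℝ) (x x' : Feat d) : ℝ :=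
  ∑ j ∈ Finset.range (k + 1), ((j ! : ℝ))⁻¹ * iteratedFDeriv ℝ j h x (fun _ => x' - x)

/-- The Hölder class `Σ(β, L, ℝ^d)` of `[0, 1]`-valued functions. -/
structure IsHolder {d : ℕ} (β L : ℝ) (h : Feat d → ℝ) : Prop where
  mem_Icc : ∀ x, h x ∈ Set.Icc (0 : ℝ) 1
  contDiff : ContDiff ℝ (⌊β⌋₊ : ℕ) h
  taylor_le : ∀ x x', |h x' - taylorPoly ⌊β⌋₊ h x x'| ≤ L * ‖x - x'‖ ^ β

/-- `(c₀, r₀)`-regular subsets of `ℝ^d`. -/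
def IsRegularSet {d : ℕ} (c₀ r₀ : ℝ) (A : Set (Feat d)) : Prop :=
  NullMeasurableSet A ∧ ∀ x ∈ A, ∀ r : ℝ, 0 < r → r ≤ r₀ →
    c₀ * volume.real (Metric.ball x r) ≤ volume.real (A ∩ Metric.ball x r)

/-- The strong density assumption for a measure `Q` on `ℝ^d`: there is a Lebesgue density which
lies in `[μmin, μmax]` on a compact `(c₀, r₀)`-regular set and vanishes outside it. -/
def StrongDensity {d : ℕ} (c₀ r₀ μmin μmax : ℝ) (Q : Measure (Feat d)) : Prop :=
  ∃ A : Set (Feat d), IsCompact A ∧ IsRegularSet c₀ r₀ A ∧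
    ∃ μ : Feat d → ℝ, Measurable μ ∧ (∀ x ∈ A, μmin ≤ μ x ∧ μ x ≤ μmax) ∧ (∀ x ∉ A, μ x = 0) ∧
      Q = volume.withDensity (fun x => ENNReal.ofReal (μ x))

/-- The class of distributions `P_Σ` on `ℝ^d × {0, 1}`. -/
def classPSigma (d : ℕ) (α C₀ δ₀ p β L c₀ r₀ μmin μmax : ℝ) : Set (Measure (Obs d)) :=
  {P | IsProbabilityMeasure P ∧ p ≤ probOne P ∧ StrongDensity c₀ r₀ μmin μmax P.fst ∧
    ∃ η : Feat d → ℝ, IsRegressionFunction P η ∧ IsHolder β L η ∧ MarginAssumption α C₀ δ₀ P η}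

/-- `n` labelled and `N` unlabelled observations. -/
abbrev SemiSample (d n N : ℕ) : Type := (Fin n → Obs d) × (Fin N → Feat d)

/-- The law `P^{⊗n} ⊗ P_X^{⊗N}` of the two data sets. -/
def sampleLaw {d : ℕ} (n N : ℕ) (P : Measure (Obs d)) : Measure (SemiSample d n N) :=
  (Measure.pi (fun _ : Fin n => P)).prod (Measure.pi (fun _ : Fin N => P.fst))

/-- Data-dependent classifiers, jointly measurable in the data and the feature. -/
def ClassifierEstimator (d n N : ℕ) : Type :=
  {g : SemiSample d n N → Feat d → Fin 2 // Measurable (Function.uncurry g)}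

/-- `E_{(D_n, D_N)} 𝓔_b(ĝ)`. -/
def expectedExcess {d n N : ℕ} (b : ℝ) (P : Measure (Obs d)) (g : ClassifierEstimator d n N) : ℝ :=
  ∫ D, excessScore b P (g.1 D) ∂(sampleLaw n N P)

/-- The minimax risk `inf_ĝ sup_{P ∈ Q} E_{(D_n, D_N)} 𝓔_b(ĝ)` over a class `Q`. -/
def minimaxExcess {d : ℕ} (b : ℝ) (n N : ℕ) (Q : Set (Measure (Obs d))) : EReal :=
  ⨅ g : ClassifierEstimator d n N, ⨆ P ∈ Q, ((expectedExcess b P g : ℝ) : EReal)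

end

open MeasureTheory
open scoped Nat

noncomputable section

/-! The bound is of Assouad type. A hypercube of distributions shares one marginal and one optimal
threshold `θ`; its vertices differ only in whether `η` lies slightly above or slightly below `θ` on
each of many small cells. The marginal has constant density on a comb of `q ^ d` cells of side `ρ /
q` together with a far cube. Since the marginal is the same at every vertex, the unlabelled sample
carries no information, and `N` does not enter the rate.

Because `θ` solves the threshold equation, the score of `g` equals `θ - I / (P(Y = 1) + P(g = 1))`,
where `I` is the integral of `|η - θ|` over the points that `g` puts on the wrong side of `θ`. The
denominator is at most 2, so the excess score is at least `I / 2`, which splits over the cells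
(`le_excessScore_regMeasure`, `sum_le_excessScore_regMeasure`).

What is particular to the F-score is that the threshold depends on the distribution. Raised bumps
have height `b * θ` and lowered ones `-b * (1 - θ)`: both states shift the threshold equation by the
same amount, so one value `farValue` of `η` on the cube makes `θ` optimal at all vertices at once.
The cube also makes `P(Y = 1)` as close to 1 as `p` demands, with `θ` slightly below `1/2`.

Three scales are balanced. Smoothness forces `b ≍ q ^ (-β)`. The margin condition allows about `q ^
(d - α * β)` active cells, a number at least 1 because `α * β ≤ d`; the other cells have `η = θ`
exactly, which the margin condition does not count. A cell has mass `w ≍ q ^ (-d)`, and flipping it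
goes undetected while `n * b ^ 2 * w` is small, whence `q ≍ n ^ (1 / (2 * β + d))`. The risk is then
of order `b * q ^ (d - α * β) * w = q ^ (-(1 + α) * β)` up to constants.

The constants of the class must not deteriorate as `q` grows: for smoothness this is
`exists_hasTaylorBound_bumpSum`, for the strong density `ofReal_le_volume_comb_inter_Ioo`. -/

/-! ### Taylor bounds: linear combinations, rescaling, smooth functions. -/

/-- `h` is `⌊β⌋` times continuously differentiable, with Taylor remainder at most `L ‖x - x'‖ ^ β`. -/
def HasTaylorBound {d : ℕ} (β L : ℝ) (h : Feat d → ℝ) : Prop :=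
  ContDiff ℝ (⌊β⌋₊ : ℕ) h ∧
    ∀ x x', |h x' - taylorPoly ⌊β⌋₊ h x x'| ≤ L * ‖x - x'‖ ^ β

namespace HasTaylorBound

variable {d : ℕ} {β L L' : ℝ} {h h' : Feat d → ℝ}

theorem mono (H : HasTaylorBound β L h) (hL : L ≤ L') : HasTaylorBound β L' h :=
  ⟨H.1, fun x x' => (H.2 x x').trans (by gcongr)⟩

theorem add (H : HasTaylorBound β L h) (H' : HasTaylorBound β L' h') :
    HasTaylorBound β (L + L') (fun x => h x + h' x) := by
  refine ⟨H.1.add H'.1, fun x x' => ?_⟩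
  have e : taylorPoly ⌊β⌋₊ (fun x => h x + h' x) x x' =
      taylorPoly ⌊β⌋₊ h x x' + taylorPoly ⌊β⌋₊ h' x x' := by
    unfold taylorPoly
    rw [← Finset.sum_add_distrib]
    refine Finset.sum_congr rfl fun j hj => ?_
    have hj' : j ≤ ⌊β⌋₊ := Nat.lt_succ_iff.mp (Finset.mem_range.mp hj)
    rw [fun_iteratedFDeriv_add_apply
      (H.1.of_le (by exact_mod_cast hj')).contDiffAt (H'.1.of_le (by exact_mod_cast hj')).contDiffAt]
    simp [mul_add]
  rw [e]
  calc _ = |(h x' - taylorPoly ⌊β⌋₊ h x x') + (h' x' - taylorPoly ⌊β⌋₊ h' x x')| := by ring_nf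
    _ ≤ _ := (abs_add_le _ _).trans (by linarith [H.2 x x', H'.2 x x'])

theorem const_mul (H : HasTaylorBound β L h) (c : ℝ) :
    HasTaylorBound β (|c| * L) (fun x => c * h x) := by
  refine ⟨contDiff_const.mul H.1, fun x x' => ?_⟩
  have e : taylorPoly ⌊β⌋₊ (fun x => c * h x) x x' = c * taylorPoly ⌊β⌋₊ h x x' := by
    unfold taylorPoly
    rw [Finset.mul_sum]
    refine Finset.sum_congr rfl fun j hj => ?_
    have hj' : j ≤ ⌊β⌋₊ := Nat.lt_succ_iff.mp (Finset.mem_range.mp hj)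
    have := iteratedFDeriv_const_smul_apply (𝕜 := ℝ) (i := j) (a := c) (f := h) (x := x)
      (H.1.of_le (by exact_mod_cast hj')).contDiffAt
    have e2 : (fun x => c * h x) = c • h := rfl
    rw [e2, this]
    simp
    ring
  rw [e, ← mul_sub, abs_mul, mul_assoc]
  gcongr
  exact H.2 x x'

theorem const (c : ℝ) (β : ℝ) : HasTaylorBound β 0 (fun _ : Feat d => c) := by
  refine ⟨contDiff_const, fun x x' => ?_⟩
  have e : taylorPoly ⌊β⌋₊ (fun _ : Feat d => c) x x' = c := by
    unfold taylorPoly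
    rw [Finset.sum_eq_single 0]
    · simp
    · intro j _ hj
      simp [iteratedFDeriv_const_of_ne hj]
    · simp
  simp [e]

/-- The factor `l ^ j` of the `j`-th derivative can be moved into the displacement, so Taylor
polynomials commute with dilation and only the remainder `‖x - x'‖ ^ β` is rescaled. -/
theorem comp_smul (H : HasTaylorBound β L h) {l : ℝ} (hl : 0 ≤ l) :
    HasTaylorBound β (L * l ^ β) (fun x => h (l • x)) := by
  refine ⟨H.1.comp (contDiff_const_smul l), fun x x' => ?_⟩
  have e : taylorPoly ⌊β⌋₊ (fun x => h (l • x)) x x' = taylorPoly ⌊β⌋₊ h (l • x) (l • x') := by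
    unfold taylorPoly
    refine Finset.sum_congr rfl fun j hj => ?_
    have hj' : j ≤ ⌊β⌋₊ := Nat.lt_succ_iff.mp (Finset.mem_range.mp hj)
    rw [iteratedFDeriv_comp_const_smul l (H.1.of_le (by exact_mod_cast hj')), ← smul_sub]
    have := (iteratedFDeriv ℝ j h (l • x)).map_smul_univ (fun _ => l) (fun _ => x' - x)
    simp only [Finset.prod_const, Finset.card_univ, Fintype.card_fin] at this
    rw [this]
    simp
  rw [e]
  refine (H.2 _ _).trans (le_of_eq ?_)
  rw [← smul_sub, norm_smul, Real.norm_of_nonneg hl, Real.mul_rpow hl (norm_nonneg _), mul_assoc]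

end HasTaylorBound

/-- A smooth function whose derivatives up to order `⌊β⌋ + 1` are bounded has a Taylor bound. -/
theorem hasTaylorBound_of_norm_iteratedFDeriv_le {d : ℕ} {β M : ℝ} (hβ : 0 ≤ β) {h : Feat d → ℝ}
    (hh : ContDiff ℝ ((⌊β⌋₊ + 1 : ℕ) : WithTop ℕ∞) h)
    (hM : ∀ j ≤ ⌊β⌋₊ + 1, ∀ x, ‖iteratedFDeriv ℝ j h x‖ ≤ M) :
    HasTaylorBound β ((⌊β⌋₊ + 2) * M) h := by
  set k := ⌊β⌋₊ with hk
  refine ⟨hh.of_le (by norm_cast; omega), fun x x' => ?_⟩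
  have hM0 : 0 ≤ M := (norm_nonneg _).trans (hM 0 (by omega) x)
  have hkβ : (k : ℝ) ≤ β := Nat.floor_le hβ
  have hβk : β ≤ (k + 1 : ℕ) := by push_cast; exact (Nat.lt_floor_add_one β).le
  set v := x' - x with hv
  have hxv : ‖x - x'‖ = ‖v‖ := norm_sub_rev _ _
  have hD : ∀ j ≤ k + 1, ∀ y, |iteratedFDeriv ℝ j h y (fun _ => v)| ≤ M * ‖v‖ ^ j := by
    intro j hj y
    have := (iteratedFDeriv ℝ j h y).le_opNorm (fun _ => v)
    simp only [Finset.prod_const, Finset.card_univ, Fintype.card_fin, Real.norm_eq_abs] at this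
    exact this.trans (by gcongr; exact hM j hj y)
  have hfac : ∀ j : ℕ, ((j ! : ℝ))⁻¹ ≤ 1 := fun j =>
    inv_le_one_of_one_le₀ (by exact_mod_cast Nat.one_le_iff_ne_zero.mpr (Nat.factorial_ne_zero j))
  have hT : ∀ j ≤ k + 1, ∀ y, |((j ! : ℝ))⁻¹ * iteratedFDeriv ℝ j h y (fun _ => v)| ≤ M * ‖v‖ ^ j := by
    intro j hj y
    rw [abs_mul, abs_of_nonneg (by positivity : (0 : ℝ) ≤ (j ! : ℝ)⁻¹)]
    exact (mul_le_of_le_one_left (abs_nonneg _) (hfac j)).trans (hD j hj y)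
  rw [hxv]
  -- Short displacements use the integral remainder of order `k + 1 ≥ β`; for long ones every term
  -- is already at most `M * ‖v‖ ^ k` with `k ≤ β`, and no cancellation is needed.
  rcases le_total ‖v‖ 1 with h1 | h1
  · have key := map_add_eq_sum_add_integral_iteratedFDeriv (f := h) (x := x) (y := v) (n := k)
      (fun t _ => by exact_mod_cast hh.contDiffAt)
    have hx' : x + v = x' := by simp [hv]
    rw [hx'] at key
    have e : h x' - taylorPoly k h x x' =
        (k ! : ℝ)⁻¹ • ∫ t in (0 : ℝ)..1, (1 - t)^k •
          iteratedFDeriv ℝ (k + 1) h (x + t • v) (fun _ ↦ v) := by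
      rw [key]; simp [taylorPoly, hv]
    have hI : ‖∫ t in (0 : ℝ)..1, (1 - t)^k • iteratedFDeriv ℝ (k + 1) h (x + t • v) (fun _ ↦ v)‖
        ≤ (M * ‖v‖ ^ (k + 1)) * |1 - 0| := by
      refine intervalIntegral.norm_integral_le_of_norm_le_const fun t ht => ?_
      rw [Set.uIoc_of_le zero_le_one] at ht
      rw [norm_smul, Real.norm_eq_abs, Real.norm_eq_abs]
      have h0 : |(1 - t) ^ k| ≤ 1 := by
        rw [abs_pow]
        exact pow_le_one₀ (abs_nonneg _) (by rw [abs_le]; constructor <;> linarith [ht.1, ht.2])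
      exact (mul_le_of_le_one_left (abs_nonneg _) h0).trans (hD _ le_rfl _)
    rw [e, smul_eq_mul, abs_mul, abs_of_nonneg (by positivity : (0 : ℝ) ≤ (k ! : ℝ)⁻¹)]
    have hpow : ‖v‖ ^ (k + 1) ≤ ‖v‖ ^ β := by
      rw [← Real.rpow_natCast]
      rcases (norm_nonneg v).eq_or_lt with h0 | h0
      · rw [← h0, Real.zero_rpow (by positivity)]; positivity
      · exact Real.rpow_le_rpow_of_exponent_ge h0 h1 hβk
    calc _ ≤ M * ‖v‖ ^ (k + 1) := by
          refine (mul_le_of_le_one_left (abs_nonneg _) (hfac k)).trans ?_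
          simpa using hI
      _ ≤ M * ‖v‖ ^ β := by gcongr
      _ ≤ ((k : ℝ) + 2) * M * ‖v‖ ^ β := by
          rw [mul_assoc]
          exact le_mul_of_one_le_left (by positivity) (by linarith [k.cast_nonneg (α := ℝ)])
  · have hpow : ‖v‖ ^ k ≤ ‖v‖ ^ β := by
      rw [← Real.rpow_natCast]
      exact Real.rpow_le_rpow_of_exponent_le h1 hkβ
    have h2 : |taylorPoly k h x x'| ≤ (k + 1) * (M * ‖v‖ ^ k) := by
      unfold taylorPoly
      refine (Finset.abs_sum_le_sum_abs _ _).trans ?_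
      refine (Finset.sum_le_card_nsmul _ _ (M * ‖v‖ ^ k) fun j hj => ?_).trans (by simp)
      have hj' : j ≤ k := Nat.lt_succ_iff.mp (Finset.mem_range.mp hj)
      refine (hT j (by omega) x).trans ?_
      gcongr
    have h3 : |h x'| ≤ M * ‖v‖ ^ k := by
      have := hM 0 (by omega) x'
      rw [norm_iteratedFDeriv_zero] at this
      exact this.trans (le_mul_of_one_le_right hM0 (one_le_pow₀ h1))
    calc _ ≤ |h x'| + |taylorPoly k h x x'| := abs_sub _ _
      _ ≤ ((k : ℝ) + 2) * M * ‖v‖ ^ k := by linarith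
      _ ≤ _ := by gcongr

/-! ### Bumps at lattice points. -/

/-- A smooth bump: equal to `1` on the ball of radius `1/4`, supported in the ball of radius `1/3`. -/
def unitBump (d : ℕ) : ContDiffBump (0 : Feat d) := ⟨1 / 4, 1 / 3, by norm_num, by norm_num⟩

theorem unitBump_eq_one {d : ℕ} {x : Feat d} (hx : ‖x‖ ≤ 1 / 4) : unitBump d x = 1 :=
  (unitBump d).one_of_mem_closedBall (by simpa [unitBump] using hx)

theorem unitBump_eq_zero {d : ℕ} {x : Feat d} (hx : 1 / 3 ≤ ‖x‖) : unitBump d x = 0 :=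
  (unitBump d).zero_of_le_dist (by simpa [unitBump] using hx)

theorem exists_bound_iteratedFDeriv_unitBump (d k : ℕ) :
    ∃ M : ℝ, ∀ j ≤ k, ∀ x, ‖iteratedFDeriv ℝ j (unitBump d) x‖ ≤ M := by
  have : ∀ j : ℕ, ∃ M : ℝ, ∀ x, ‖iteratedFDeriv ℝ j (unitBump d) x‖ ≤ M := fun j =>
    (((unitBump d).hasCompactSupport.iteratedFDeriv (𝕜 := ℝ) j).exists_bound_of_continuous
      (((unitBump d).contDiff (n := (j : ℕ))).continuous_iteratedFDeriv le_rfl))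
  choose M hM using this
  refine ⟨∑ i ∈ Finset.range (k + 1), M i, fun j hj x => (hM j x).trans ?_⟩
  exact Finset.single_le_sum (f := M) (fun i _ => (norm_nonneg _).trans (hM i 0))
    (Finset.mem_range.mpr (by omega))

/-- The point of `ℝ^d` with the given natural coordinates. -/
def latticePt {d q : ℕ} (J : Fin d → Fin q) : Feat d := WithLp.toLp 2 fun i => ((J i : ℕ) : ℝ)

theorem one_le_norm_latticePt_sub {d q : ℕ} {J K : Fin d → Fin q} (h : J ≠ K) :
    1 ≤ ‖latticePt J - latticePt K‖ := by
  obtain ⟨i, hi⟩ := Function.ne_iff.mp h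
  refine le_trans ?_ (PiLp.norm_apply_le (latticePt J - latticePt K) i)
  have h1 : ((J i : ℕ) : ℤ) - ((K i : ℕ) : ℤ) ≠ 0 := by
    intro h0
    exact hi (Fin.ext (by omega))
  have h2 := Int.one_le_abs h1
  have : (latticePt J - latticePt K) i = ((((J i : ℕ) : ℤ) - ((K i : ℕ) : ℤ) : ℤ) : ℝ) := by
    simp [latticePt]
  rw [this, Real.norm_eq_abs]
  exact_mod_cast h2

/-- At most one of the translated bumps is nonzero at any point. -/
theorem latticePt_eq_of_norm_lt {d q : ℕ} {J K : Fin d → Fin q} {x : Feat d}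
    (hJ : ‖x - latticePt J‖ < 1 / 2) (hK : ‖x - latticePt K‖ ≤ 1 / 2) : J = K := by
  by_contra h
  have := one_le_norm_latticePt_sub h
  have h2 : ‖latticePt J - latticePt K‖ ≤ ‖x - latticePt K‖ + ‖x - latticePt J‖ := by
    have := norm_sub_le (x - latticePt K) (x - latticePt J)
    simpa using this
  linarith

/-- A combination of bumps centred at lattice points. -/
def bumpSum {d q : ℕ} (T : Finset (Fin d → Fin q)) (a : (Fin d → Fin q) → ℝ) (x : Feat d) : ℝ :=
  ∑ J ∈ T, a J * unitBump d (x - latticePt J)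

theorem bumpSum_eq_zero {d q : ℕ} {T : Finset (Fin d → Fin q)} {a : (Fin d → Fin q) → ℝ}
    {x : Feat d} (h : ∀ J ∈ T, 1 / 3 ≤ ‖x - latticePt J‖) : bumpSum T a x = 0 :=
  Finset.sum_eq_zero fun J hJ => by rw [unitBump_eq_zero (h J hJ), mul_zero]

theorem bumpSum_eq {d q : ℕ} {T : Finset (Fin d → Fin q)} {a : (Fin d → Fin q) → ℝ}
    {x : Feat d} {J : Fin d → Fin q} (hJ : J ∈ T) (h : ‖x - latticePt J‖ < 1 / 2) :
    bumpSum T a x = a J * unitBump d (x - latticePt J) := by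
  unfold bumpSum
  refine Finset.sum_eq_single J (fun K _ hK => ?_) (fun h => absurd hJ h)
  rw [unitBump_eq_zero, mul_zero]
  by_contra hc
  exact hK (latticePt_eq_of_norm_lt h (by linarith)).symm

/-- Lattice points are at distance at least 1 and the bumps have radius `1/3`, so at each point at
most one summand has nonzero derivatives. The derivative bounds of a single bump therefore serve all
`q`, `T` and `a`. -/
theorem exists_hasTaylorBound_bumpSum (d : ℕ) {β : ℝ} (hβ : 0 ≤ β) :
    ∃ L₀ : ℝ, 0 < L₀ ∧ HasTaylorBound β L₀ (unitBump d) ∧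
      ∀ (q : ℕ) (T : Finset (Fin d → Fin q)) (a : (Fin d → Fin q) → ℝ), (∀ J, |a J| ≤ 1) →
        HasTaylorBound β L₀ (bumpSum T a) := by
  obtain ⟨M, hM⟩ := exists_bound_iteratedFDeriv_unitBump d (⌊β⌋₊ + 1)
  have hM0 : 0 ≤ M := (norm_nonneg _).trans (hM 0 (by omega) 0)
  have hk : (0 : ℝ) < ⌊β⌋₊ + 2 := by positivity
  refine ⟨(⌊β⌋₊ + 2) * (M + 1), by positivity, ?_, fun q T a ha => ?_⟩
  · refine (hasTaylorBound_of_norm_iteratedFDeriv_le hβ (unitBump d).contDiff hM).mono ?_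
    gcongr; linarith
  refine (hasTaylorBound_of_norm_iteratedFDeriv_le (M := M) hβ ?_ fun j hj x => ?_).mono
    (by gcongr; linarith)
  · refine ContDiff.sum fun J _ => contDiff_const.mul ?_
    exact (unitBump d).contDiff.comp (contDiff_id.sub contDiff_const)
  · have hc : ∀ J ∈ T, ContDiffAt ℝ j (fun z : Feat d => a J * unitBump d (z - latticePt J)) x :=
      fun J _ => contDiffAt_const.mul
        (((unitBump d).contDiff.comp (contDiff_id.sub contDiff_const)).contDiffAt)
    have hterm : ∀ J, iteratedFDeriv ℝ j (fun z : Feat d => a J * unitBump d (z - latticePt J)) x =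
        a J • iteratedFDeriv ℝ j (unitBump d) (x - latticePt J) := by
      intro J
      have h1 := iteratedFDeriv_const_smul_apply (𝕜 := ℝ) (i := j) (a := a J)
        (f := fun z : Feat d => unitBump d (z - latticePt J)) (x := x)
        (((unitBump d).contDiff.comp (contDiff_id.sub contDiff_const)).contDiffAt)
      rw [iteratedFDeriv_comp_sub] at h1
      exact h1
    have hbs : bumpSum T a = fun z => ∑ J ∈ T, a J * unitBump d (z - latticePt J) := rfl
    rw [hbs, iteratedFDeriv_fun_sum_apply hc]
    simp_rw [hterm]
    have hz : ∀ J : Fin d → Fin q, 1 / 2 ≤ ‖x - latticePt J‖ →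
        iteratedFDeriv ℝ j (unitBump d) (x - latticePt J) = 0 := by
      intro J hJ
      by_contra hne
      have := support_iteratedFDeriv_subset (𝕜 := ℝ) j (Function.mem_support.mpr hne)
      rw [(unitBump d).tsupport_eq] at this
      have : ‖x - latticePt J‖ ≤ 1 / 3 := by simpa [unitBump] using this
      linarith
    by_cases hex : ∃ J ∈ T, ‖x - latticePt J‖ < 1 / 2
    · obtain ⟨J, hJ, hJx⟩ := hex
      rw [Finset.sum_eq_single J (fun K _ hK => ?_) (fun h => absurd hJ h)]
      · rw [norm_smul, Real.norm_eq_abs]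
        exact (mul_le_of_le_one_left (norm_nonneg _) (ha J)).trans (hM j hj _)
      · rw [hz K, smul_zero]
        by_contra hc
        exact hK (latticePt_eq_of_norm_lt hJx (by linarith)).symm
    · push Not at hex
      rw [Finset.sum_eq_zero fun J hJ => by rw [hz J (hex J hJ), smul_zero], norm_zero]
      exact hM0

/-! ### Distributions with prescribed marginal and regression function, and their excess score. -/

/-- The distribution on `ℝ^d × {0, 1}` with marginal `Q` and regression function `η`. -/
def regMeasure {d : ℕ} (Q : Measure (Feat d)) (η : Feat d → ℝ) : Measure (Obs d) :=
  (Q.prod Measure.count).withDensity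
    fun z => ENNReal.ofReal (if z.2 = 1 then η z.1 else 1 - η z.1)

section RegMeasure

variable {d : ℕ} {Q : Measure (Feat d)} {η : Feat d → ℝ}

theorem measurable_labelDensity (hη : Measurable η) :
    Measurable fun z : Obs d => if z.2 = 1 then η z.1 else 1 - η z.1 :=
  Measurable.ite (measurable_snd (measurableSet_singleton _)) (hη.comp measurable_fst)
    (measurable_const.sub (hη.comp measurable_fst))

theorem regMeasure_apply [SFinite Q] (hη : Measurable η) {E : Set (Obs d)} (hE : MeasurableSet E) :
    regMeasure Q η E = ∫⁻ x, (E.indicator 1 (x, 0) * ENNReal.ofReal (1 - η x) +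
      E.indicator 1 (x, 1) * ENNReal.ofReal (η x)) ∂Q := by
  have hm := (measurable_labelDensity hη).ennreal_ofReal
  rw [regMeasure, withDensity_apply _ hE, ← lintegral_indicator hE,
    lintegral_prod _ (hm.indicator hE).aemeasurable]
  refine lintegral_congr fun x => ?_
  rw [lintegral_count, tsum_fintype, Fin.sum_univ_two]
  congr 1 <;> simp [Set.indicator]

variable [IsProbabilityMeasure Q]

theorem regMeasure_fst (hη : Measurable η) (h01 : ∀ x, η x ∈ Set.Icc (0 : ℝ) 1) :
    (regMeasure Q η).fst = Q := by
  ext s hs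
  rw [Measure.fst_apply hs, regMeasure_apply hη (measurable_fst hs), ← setLIntegral_one,
    ← lintegral_indicator hs]
  refine lintegral_congr fun x => ?_
  by_cases hx : x ∈ s
  · simp only [Set.indicator, Set.mem_preimage, hx, if_true, Pi.one_apply, one_mul]
    rw [← ENNReal.ofReal_add (by linarith [(h01 x).2]) (h01 x).1]
    simp
  · simp [hx]

theorem isProbabilityMeasure_regMeasure (hη : Measurable η) (h01 : ∀ x, η x ∈ Set.Icc (0 : ℝ) 1) :
    IsProbabilityMeasure (regMeasure Q η) := by
  constructor
  rw [← Measure.fst_univ, regMeasure_fst hη h01, measure_univ]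

theorem integrable_of_mem_Icc (hη : Measurable η) (h01 : ∀ x, η x ∈ Set.Icc (0 : ℝ) 1) :
    Integrable η Q :=
  Integrable.of_mem_Icc 0 1 hη.aemeasurable (ae_of_all _ h01)

theorem regMeasure_real_label_one (hη : Measurable η) (h01 : ∀ x, η x ∈ Set.Icc (0 : ℝ) 1)
    {s : Set (Feat d)} (hs : MeasurableSet s) :
    (regMeasure Q η).real {z | z.1 ∈ s ∧ z.2 = 1} = ∫ x in s, η x ∂Q := by
  have hE : MeasurableSet {z : Obs d | z.1 ∈ s ∧ z.2 = 1} :=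
    (measurable_fst hs).inter (measurable_snd (measurableSet_singleton 1))
  rw [integral_eq_lintegral_of_nonneg_ae (ae_of_all _ fun x => (h01 x).1)
    hη.aestronglyMeasurable, Measure.real, regMeasure_apply hη hE, ← lintegral_indicator hs]
  congr 1
  refine lintegral_congr fun x => ?_
  by_cases hx : x ∈ s <;> simp [Set.indicator, hx]

theorem regMeasure_real_feature (hη : Measurable η) (h01 : ∀ x, η x ∈ Set.Icc (0 : ℝ) 1)
    {s : Set (Feat d)} (hs : MeasurableSet s) :
    (regMeasure Q η).real {z | z.1 ∈ s} = Q.real s := by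
  conv_rhs => rw [← regMeasure_fst (Q := Q) hη h01]
  rw [Measure.real, Measure.real, Measure.fst_apply hs]
  rfl

theorem isRegressionFunction_regMeasure (hη : Measurable η) (h01 : ∀ x, η x ∈ Set.Icc (0 : ℝ) 1) :
    IsRegressionFunction (regMeasure Q η) η where
  measurable := hη
  mem_Icc := h01
  setIntegral_eq s hs := by rw [regMeasure_fst hη h01, regMeasure_real_label_one hη h01 hs]

theorem probOne_regMeasure (hη : Measurable η) (h01 : ∀ x, η x ∈ Set.Icc (0 : ℝ) 1) :
    probOne (regMeasure Q η) = ∫ x, η x ∂Q := by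
  have := regMeasure_real_label_one (Q := Q) hη h01 MeasurableSet.univ
  simpa [probOne] using this

theorem fScore_regMeasure (hη : Measurable η) (h01 : ∀ x, η x ∈ Set.Icc (0 : ℝ) 1)
    {g : Feat d → Fin 2} (hg : Measurable g) :
    fScore 1 (regMeasure Q η) g =
      (∫ x in {x | g x = 1}, η x ∂Q) / (∫ x, η x ∂Q + Q.real {x | g x = 1}) := by
  have hs : MeasurableSet {x | g x = 1} := hg (measurableSet_singleton 1)
  rw [fScore, probOne_regMeasure hη h01, one_pow, one_mul]
  congr 1
  · rw [← regMeasure_real_label_one hη h01 hs]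
    congr 1
    ext z
    simp [and_comm]
  · congr 1
    simpa using regMeasure_real_feature (Q := Q) hη h01 hs

theorem fScore_regMeasure_mem_Icc (hη : Measurable η) (h01 : ∀ x, η x ∈ Set.Icc (0 : ℝ) 1)
    {g : Feat d → Fin 2} (hg : Measurable g) :
    fScore 1 (regMeasure Q η) g ∈ Set.Icc (0 : ℝ) 1 := by
  have hi := integrable_of_mem_Icc (Q := Q) hη h01
  rw [fScore_regMeasure hη h01 hg]
  have h1 : 0 ≤ ∫ x in {x | g x = 1}, η x ∂Q := integral_nonneg fun x => (h01 x).1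
  have h2 : ∫ x in {x | g x = 1}, η x ∂Q ≤ ∫ x, η x ∂Q :=
    setIntegral_le_integral hi (ae_of_all _ fun x => (h01 x).1)
  have h3 : 0 ≤ Q.real {x | g x = 1} := measureReal_nonneg
  exact ⟨div_nonneg h1 (by linarith), div_le_one_of_le₀ (by linarith) (by linarith)⟩

theorem excessScore_regMeasure_mem_Icc (hη : Measurable η) (h01 : ∀ x, η x ∈ Set.Icc (0 : ℝ) 1)
    {g : Feat d → Fin 2} (hg : Measurable g) :
    excessScore 1 (regMeasure Q η) g ∈ Set.Icc (0 : ℝ) 1 := by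
  have hb : BddAbove (Set.range fun f : {f : Feat d → Fin 2 // Measurable f} =>
      fScore 1 (regMeasure Q η) f.1) :=
    ⟨1, by rintro _ ⟨f, rfl⟩; exact (fScore_regMeasure_mem_Icc hη h01 f.2).2⟩
  have : Nonempty {f : Feat d → Fin 2 // Measurable f} := ⟨⟨g, hg⟩⟩
  have h1 := le_ciSup hb ⟨g, hg⟩
  have h2 : (⨆ f : {f : Feat d → Fin 2 // Measurable f}, fScore 1 (regMeasure Q η) f.1) ≤ 1 :=
    ciSup_le fun f => (fScore_regMeasure_mem_Icc hη h01 f.2).2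
  have h3 := (fScore_regMeasure_mem_Icc (Q := Q) hη h01 hg).1
  unfold excessScore
  exact ⟨by simpa using h1, by linarith⟩

/-- The excess score is bounded below by the cost-sensitive excess risk at the optimal threshold. -/
theorem le_excessScore_regMeasure (hη : Measurable η) (h01 : ∀ x, η x ∈ Set.Icc (0 : ℝ) 1)
    {θ : ℝ} (hpos : 0 < ∫ x, η x ∂Q)
    (hθ : θ * ∫ x, η x ∂Q = ∫ x, max (η x - θ) 0 ∂Q) {g : Feat d → Fin 2} (hg : Measurable g) :
    (1 / 2) * ∫ x, (max (η x - θ) 0 - {x | g x = 1}.indicator (fun x => η x - θ) x) ∂Q ≤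
      excessScore 1 (regMeasure Q η) g := by
  classical
  have hi := integrable_of_mem_Icc (Q := Q) hη h01
  have hiθ : Integrable (fun x => η x - θ) Q := hi.sub (integrable_const θ)
  have him : Integrable (fun x => max (η x - θ) 0) Q := hiθ.pos_part
  have hsub : ∀ s : Set (Feat d), MeasurableSet s →
      ∫ x in s, (η x - θ) ∂Q = ∫ x in s, η x ∂Q - θ * Q.real s := by
    intro s _
    rw [integral_sub hi.integrableOn (integrable_const θ)]
    simp [mul_comm]
  have hgs : MeasurableSet {x | g x = 1} := hg (measurableSet_singleton 1)
  -- Thresholding at `θ` attains the score `θ`: this is the threshold equation rearranged. Only this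
  -- lower bound on the supremum is needed.
  set f : Feat d → Fin 2 := fun x => if θ < η x then 1 else 0 with hf
  have hfs : {x | f x = 1} = {x | θ < η x} := by
    ext x; simp [hf]
  have hms : MeasurableSet {x | θ < η x} := measurableSet_lt measurable_const hη
  have hfm : Measurable f := Measurable.ite hms measurable_const measurable_const
  have hmax : ∫ x, max (η x - θ) 0 ∂Q = ∫ x in {x | θ < η x}, (η x - θ) ∂Q := by
    rw [← integral_indicator hms]
    refine integral_congr_ae (ae_of_all _ fun x => ?_)
    by_cases hx : θ < η x
    · simp [Set.indicator, hx, hx.le]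
    · simp [Set.indicator, hx, not_lt.mp hx]
  have hF : fScore 1 (regMeasure Q η) f = θ := by
    rw [fScore_regMeasure hη h01 hfm, hfs]
    have h0 : 0 ≤ Q.real {x | θ < η x} := measureReal_nonneg
    rw [div_eq_iff (by positivity)]
    have := hsub _ hms
    linarith
  have hb : BddAbove (Set.range fun f : {f : Feat d → Fin 2 // Measurable f} =>
      fScore 1 (regMeasure Q η) f.1) :=
    ⟨1, by rintro _ ⟨f, rfl⟩; exact (fScore_regMeasure_mem_Icc hη h01 f.2).2⟩
  have hsup : θ ≤ ⨆ f : {f : Feat d → Fin 2 // Measurable f}, fScore 1 (regMeasure Q η) f.1 :=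
    hF.symm.le.trans (le_ciSup hb ⟨f, hfm⟩)
  have hint : ∫ x, (max (η x - θ) 0 - {x | g x = 1}.indicator (fun x => η x - θ) x) ∂Q =
      θ * ∫ x, η x ∂Q - ∫ x in {x | g x = 1}, (η x - θ) ∂Q := by
    rw [integral_sub him (hiθ.indicator hgs), integral_indicator hgs, hθ]
  have hnn : 0 ≤ ∫ x, (max (η x - θ) 0 - {x | g x = 1}.indicator (fun x => η x - θ) x) ∂Q := by
    refine integral_nonneg fun x => ?_
    by_cases hx : g x = 1 <;> simp [Set.indicator, hx]
  set I := ∫ x, (max (η x - θ) 0 - {x | g x = 1}.indicator (fun x => η x - θ) x) ∂Q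
  have hQ1 : Q.real {x | g x = 1} ≤ 1 := measureReal_le_one
  have hQ0 : 0 ≤ Q.real {x | g x = 1} := measureReal_nonneg
  have hπ1 : ∫ x, η x ∂Q ≤ 1 := by
    have := integral_mono hi (integrable_const (1 : ℝ)) fun x => (h01 x).2
    simpa using this
  have hFg : fScore 1 (regMeasure Q η) g = θ - I / (∫ x, η x ∂Q + Q.real {x | g x = 1}) := by
    rw [fScore_regMeasure hη h01 hg, hint, hsub _ hgs]
    have : ∫ x, η x ∂Q + Q.real {x | g x = 1} ≠ 0 := by positivity
    field_simp
    ring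
  -- The denominator is a sum of two probabilities, hence at most 2.
  have hle : (1 / 2) * I ≤ I / (∫ x, η x ∂Q + Q.real {x | g x = 1}) := by
    rw [le_div_iff₀ (by positivity)]
    nlinarith
  rw [excessScore, hFg]
  linarith

/-- The excess score counts the cells on which a classifier errs. -/
theorem sum_le_excessScore_regMeasure {ι : Type*} (hη : Measurable η)
    (h01 : ∀ x, η x ∈ Set.Icc (0 : ℝ) 1) {θ : ℝ} (hpos : 0 < ∫ x, η x ∂Q)
    (hθ : θ * ∫ x, η x ∂Q = ∫ x, max (η x - θ) 0 ∂Q) {g : Feat d → Fin 2} (hg : Measurable g)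
    (T : Finset ι) (C : ι → Set (Feat d)) (hC : ∀ j ∈ T, MeasurableSet (C j))
    (hdisj : ∀ i ∈ T, ∀ j ∈ T, i ≠ j → Disjoint (C i) (C j)) (s : ι → Fin 2) {h : ℝ}
    (h1 : ∀ j ∈ T, s j = 1 → ∀ x ∈ C j, h ≤ η x - θ)
    (h0 : ∀ j ∈ T, s j ≠ 1 → ∀ x ∈ C j, η x - θ ≤ -h) :
    h / 2 * ∑ j ∈ T, Q.real (C j ∩ {x | g x ≠ s j}) ≤ excessScore 1 (regMeasure Q η) g := by
  classical
  have hi := integrable_of_mem_Icc (Q := Q) hη h01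
  have hiθ : Integrable (fun x => η x - θ) Q := hi.sub (integrable_const θ)
  have him : Integrable (fun x => max (η x - θ) 0) Q := hiθ.pos_part
  have hgs : MeasurableSet {x | g x = 1} := hg (measurableSet_singleton 1)
  have hE : ∀ j ∈ T, MeasurableSet (C j ∩ {x | g x ≠ s j}) := fun j hj =>
    (hC j hj).inter (hg (measurableSet_singleton (s j)).compl)
  refine le_trans ?_ (le_excessScore_regMeasure hη h01 hpos hθ hg)
  have e : h / 2 * ∑ j ∈ T, Q.real (C j ∩ {x | g x ≠ s j}) =
      (1 / 2) * ∫ x, ∑ j ∈ T, (C j ∩ {x | g x ≠ s j}).indicator (fun _ => h) x ∂Q := by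
    rw [integral_finsetSum _ fun j hj => (integrable_const h).indicator (hE j hj)]
    rw [Finset.mul_sum, Finset.mul_sum]
    refine Finset.sum_congr rfl fun j hj => ?_
    rw [integral_indicator (hE j hj)]
    simp
    ring
  rw [e]
  refine mul_le_mul_of_nonneg_left (integral_mono (integrable_finsetSum _ fun j hj =>
    (integrable_const h).indicator (hE j hj)) (him.sub (hiθ.indicator hgs)) fun x => ?_)
    (by norm_num)
  have hnn : 0 ≤ max (η x - θ) 0 - {x | g x = 1}.indicator (fun x => η x - θ) x := by
    by_cases hx : g x = 1 <;> simp [Set.indicator, hx]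
  -- Disjointness leaves at most one nonzero indicator, and on an error the integrand on the right
  -- is `|η x - θ| ≥ h`.
  by_cases hex : ∃ j ∈ T, x ∈ C j ∩ {x | g x ≠ s j}
  · obtain ⟨j, hj, hx⟩ := hex
    show ∑ j ∈ T, (C j ∩ {x | g x ≠ s j}).indicator (fun _ => h) x ≤ _
    rw [Finset.sum_eq_single j (fun k hk hkj => Set.indicator_of_notMem (fun hc =>
      Set.disjoint_left.mp (hdisj k hk j hj hkj) hc.1 hx.1) _) (fun hc => absurd hj hc),
      Set.indicator_of_mem hx]
    have hgx : g x ≠ s j := hx.2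
    by_cases hs : s j = 1
    · have := h1 j hj hs x hx.1
      have hg1 : g x ≠ 1 := hs ▸ hgx
      simp only [Set.indicator, Set.mem_ofPred_eq, hg1, if_false, sub_zero]
      exact this.trans (le_max_left _ _)
    · have := h0 j hj hs x hx.1
      have hg1 : g x = 1 := by omega
      simp only [Set.indicator, Set.mem_ofPred_eq, hg1, if_true]
      linarith [le_max_right (η x - θ) 0]
  · push Not at hex
    show ∑ j ∈ T, (C j ∩ {x | g x ≠ s j}).indicator (fun _ => h) x ≤ _
    rw [Finset.sum_eq_zero fun j hj => Set.indicator_of_notMem (hex j hj) _]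
    exact hnn

end RegMeasure

/-! ### Likelihood ratios of product experiments. -/

section LikelihoodRatio

variable {Z : Type*} [MeasurableSpace Z] {P : Measure Z} [IsProbabilityMeasure P] {r : Z → ℝ}

theorem pi_withDensity_ofReal {n : ℕ} (hr0 : ∀ z, 0 ≤ r z) (hi : Integrable r P)
    [SigmaFinite (P.withDensity fun z => ENNReal.ofReal (r z))] :
    Measure.pi (fun _ : Fin n => P.withDensity fun z => ENNReal.ofReal (r z)) =
      (Measure.pi fun _ : Fin n => P).withDensity
        fun z => ENNReal.ofReal (∏ i, r (z i)) := by
  refine Measure.pi_eq fun s hs => ?_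
  rw [withDensity_apply _ (MeasurableSet.univ_pi hs), Measure.restrict_pi_pi,
    ← ofReal_integral_eq_lintegral_ofReal (Integrable.fintype_prod fun i => hi.restrict)
      (ae_of_all _ fun z => Finset.prod_nonneg fun i _ => hr0 (z i)),
    integral_fintype_prod_eq_prod (fun _ => r),
    ENNReal.ofReal_prod_of_nonneg fun i _ => integral_nonneg hr0]
  refine Finset.prod_congr rfl fun i _ => ?_
  rw [withDensity_apply _ (hs i),
    ofReal_integral_eq_lintegral_ofReal hi.restrict (ae_of_all _ hr0)]

/-- Change of measure between product experiments, controlled by the `χ²`-divergence. -/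
theorem abs_integral_pi_withDensity_sub_le {n : ℕ} {Y : Type*} [MeasurableSpace Y]
    {ρ : Measure Y} [IsProbabilityMeasure ρ] (hr : Measurable r) (hr0 : ∀ z, 0 ≤ r z) {B : ℝ}
    (hrB : ∀ z, r z ≤ B) (h1 : ∫ z, r z ∂P = 1)
    [IsProbabilityMeasure (P.withDensity fun z => ENNReal.ofReal (r z))]
    {χ : ℝ} (hχ : ∫ z, (r z - 1) ^ 2 ∂P ≤ χ) {u : (Fin n → Z) × Y → ℝ} (hu : Measurable u)
    {w : ℝ} (hu0 : ∀ D, 0 ≤ u D) (huw : ∀ D, u D ≤ w) :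
    |∫ D, u D ∂((Measure.pi fun _ : Fin n => P.withDensity fun z =>
        ENNReal.ofReal (r z)).prod ρ) - ∫ D, u D ∂((Measure.pi fun _ : Fin n => P).prod ρ)| ≤
      w * (1 / 4 + ((1 + χ) ^ n - 1)) := by
  have hi : Integrable r P := Integrable.of_mem_Icc 0 B hr.aemeasurable
    (ae_of_all _ fun z => ⟨hr0 z, hrB z⟩)
  have hi2 : Integrable (fun z => r z ^ 2) P := Integrable.of_mem_Icc 0 (B ^ 2)
    (hr.pow_const 2).aemeasurable (ae_of_all _ fun z => ⟨sq_nonneg _, by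
      gcongr
      · exact hr0 z
      · exact hrB z⟩)
  set M := Measure.pi fun _ : Fin n => P
  set R : (Fin n → Z) → ℝ := fun z => ∏ i, r (z i) with hR
  have hRm : Measurable R := Finset.measurable_fun_prod _ fun i _ => hr.comp (measurable_pi_apply i)
  have hR0 : ∀ z, 0 ≤ R z := fun z => Finset.prod_nonneg fun i _ => hr0 (z i)
  have hiR : Integrable R M := Integrable.fintype_prod fun _ => hi
  have hiR2 : Integrable (fun z => R z ^ 2) M := by
    have : Integrable (fun z : Fin n → Z => ∏ i, (r (z i)) ^ 2) M :=
      Integrable.fintype_prod fun _ => hi2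
    simpa [hR, Finset.prod_pow] using this
  have hR1 : ∫ z, R z ∂M = 1 := by
    rw [hR, integral_fintype_prod_eq_pow (ι := Fin n) r, h1, one_pow]
  have hr2 : ∫ z, r z ^ 2 ∂P ≤ 1 + χ := by
    have e : ∫ z, (r z - 1) ^ 2 ∂P = ∫ z, r z ^ 2 ∂P - 1 := by
      have : (fun z => (r z - 1) ^ 2) = fun z => r z ^ 2 - (2 * r z - 1) := by ext z; ring
      have h21 : Integrable (fun z => 2 * r z - 1) P := (hi.const_mul 2).sub (integrable_const 1)
      rw [this, integral_sub hi2 h21, integral_sub (hi.const_mul 2) (integrable_const 1),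
        integral_const_mul, h1]
      norm_num
    linarith
  have hR2 : ∫ z, R z ^ 2 ∂M ≤ (1 + χ) ^ n := by
    have e : (fun z => R z ^ 2) = fun z : Fin n → Z => ∏ i, (r (z i)) ^ 2 := by
      ext z; simp [hR, Finset.prod_pow]
    rw [e, integral_fintype_prod_eq_pow (ι := Fin n) fun z => r z ^ 2, Fintype.card_fin]
    exact pow_le_pow_left₀ (integral_nonneg fun z => sq_nonneg _) hr2 n
  have hRm' : Measurable fun D : (Fin n → Z) × Y => ENNReal.ofReal (R D.1) :=
    (hRm.comp measurable_fst).ennreal_ofReal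
  rw [pi_withDensity_ofReal hr0 hi, prod_withDensity_left hRm.ennreal_ofReal,
    integral_withDensity_eq_integral_toReal_smul hRm' (ae_of_all _ fun _ => ENNReal.ofReal_lt_top)]
  simp only [ENNReal.toReal_ofReal (hR0 _), smul_eq_mul]
  have hui : Integrable u (M.prod ρ) := Integrable.of_mem_Icc 0 w hu.aemeasurable
    (ae_of_all _ fun z => ⟨hu0 z, huw z⟩)
  have hiR' : Integrable (fun D : (Fin n → Z) × Y => R D.1) (M.prod ρ) := hiR.comp_fst ρ
  have hiR2' : Integrable (fun D : (Fin n → Z) × Y => R D.1 ^ 2) (M.prod ρ) := hiR2.comp_fst ρ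
  have huR : Integrable (fun D => R D.1 * u D) (M.prod ρ) :=
    hiR'.mul_bdd (c := w) hu.aestronglyMeasurable (ae_of_all _ fun D => by
      rw [Real.norm_of_nonneg (hu0 D)]; exact huw D)
  rw [← integral_sub huR hui]
  have hdom : Integrable (fun D : (Fin n → Z) × Y => w * (1 / 4 + (R D.1 - 1) ^ 2)) (M.prod ρ) := by
    have : (fun D : (Fin n → Z) × Y => w * (1 / 4 + (R D.1 - 1) ^ 2)) =
        fun D => w * (5 / 4 + (R D.1 ^ 2 - 2 * R D.1)) := by ext; ring
    rw [this]
    exact ((integrable_const _).add (hiR2'.sub (hiR'.const_mul 2))).const_mul w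
  calc |∫ D, (R D.1 * u D - u D) ∂(M.prod ρ)|
      ≤ ∫ D, |R D.1 * u D - u D| ∂(M.prod ρ) := abs_integral_le_integral_abs
    _ ≤ ∫ D : (Fin n → Z) × Y, w * (1 / 4 + (R D.1 - 1) ^ 2) ∂(M.prod ρ) := by
        refine integral_mono (huR.sub hui).abs hdom fun D => ?_
        have : R D.1 * u D - u D = u D * (R D.1 - 1) := by ring
        simp only [this, abs_mul, abs_of_nonneg (hu0 D)]
        refine mul_le_mul (huw D) ?_ (abs_nonneg _) ((hu0 D).trans (huw D))
        -- `|t| ≤ 1/4 + t ^ 2` replaces Cauchy–Schwarz and makes the bound linear in the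
        -- `χ²`-divergence.
        nlinarith [sq_nonneg (|R D.1 - 1| - 1 / 2), sq_abs (R D.1 - 1)]
    _ = ∫ z, w * (1 / 4 + (R z - 1) ^ 2) ∂M := by
        rw [integral_fun_fst (fun z => w * (1 / 4 + (R z - 1) ^ 2))]
        simp
    _ = w * (1 / 4 + (∫ z, R z ^ 2 ∂M - 1)) := by
        have : (fun z => w * (1 / 4 + (R z - 1) ^ 2)) =
          fun z => w * (5 / 4 + (R z ^ 2 - 2 * R z)) := by ext; ring
        have h2R : Integrable (fun z => R z ^ 2 - 2 * R z) M := hiR2.sub (hiR.const_mul 2)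
        rw [this, integral_const_mul, integral_add (integrable_const _) h2R, integral_sub hiR2 (hiR.const_mul 2), integral_const_mul, hR1]
        simp only [integral_const, probReal_univ, smul_eq_mul]
        ring
    _ ≤ _ := by
        have hw : 0 ≤ w := by
          obtain ⟨D⟩ : Nonempty ((Fin n → Z) × Y) := (M.prod ρ).nonempty_of_neZero
          exact (hu0 D).trans (huw D)
        gcongr

end LikelihoodRatio

/-! ### Assouad's lemma. -/

section Assouad

variable {d : ℕ} {Q : Measure (Feat d)} [IsProbabilityMeasure Q]

/-- Two regression functions that are close on a small set cannot be told apart. -/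
theorem half_le_integral_add_integral {η η' : Feat d → ℝ} (hη : Measurable η) (hη' : Measurable η')
    (h01 : ∀ x, η x ∈ Set.Icc (0 : ℝ) 1) (h01' : ∀ x, η' x ∈ Set.Icc (0 : ℝ) 1)
    {C : Set (Feat d)} (hC : MeasurableSet C) (heq : ∀ᵐ x ∂Q, x ∉ C → η x = η' x) {Δ : ℝ}
    (hlow : ∀ x ∈ C, 1 / 4 ≤ η x) (hupp : ∀ x ∈ C, η x ≤ 3 / 4)
    (hΔ : ∀ x ∈ C, |η' x - η x| ≤ Δ) {n N : ℕ} (hn : (1 + 16 * Δ ^ 2 * Q.real C) ^ n ≤ 5 / 4)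
    {u : SemiSample d n N → ℝ} (hu : Measurable u) {w : ℝ} (hu0 : ∀ D, 0 ≤ u D)
    (huw : ∀ D, u D ≤ w) :
    w / 2 ≤ ∫ D, u D ∂(sampleLaw n N (regMeasure Q η)) +
      ∫ D, (w - u D) ∂(sampleLaw n N (regMeasure Q η')) := by
  classical
  have := isProbabilityMeasure_regMeasure (Q := Q) hη h01
  have hP' := isProbabilityMeasure_regMeasure (Q := Q) hη' h01'
  set f : Obs d → ℝ := fun z => if z.2 = 1 then η z.1 else 1 - η z.1 with hf
  set f' : Obs d → ℝ := fun z => if z.2 = 1 then η' z.1 else 1 - η' z.1 with hf'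
  have hfm : Measurable f := measurable_labelDensity hη
  have hfm' : Measurable f' := measurable_labelDensity hη'
  have hCm : MeasurableSet {z : Obs d | z.1 ∈ C} := measurable_fst hC
  -- The ratio is set to 1 off `C`, since `f` may vanish there; on `C` it is at least `1/4`, which
  -- bounds the ratio by 4 and yields the factor 16 in the divergence.
  set r : Obs d → ℝ := fun z => if z.1 ∈ C then f' z / f z else 1 with hr
  have hrm : Measurable r := Measurable.ite hCm (hfm'.div hfm) measurable_const
  have hf0 : ∀ z, 0 ≤ f z := fun z => by
    have := h01 z.1
    simp only [hf]; split_ifs <;> linarith [this.1, this.2]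
  have hf0' : ∀ z, 0 ≤ f' z := fun z => by
    have := h01' z.1
    simp only [hf']; split_ifs <;> linarith [this.1, this.2]
  have hf1' : ∀ z, f' z ≤ 1 := fun z => by
    have := h01' z.1
    simp only [hf']; split_ifs <;> linarith [this.1, this.2]
  have hfC : ∀ z : Obs d, z.1 ∈ C → 1 / 4 ≤ f z := fun z hz => by
    have h1 := hlow z.1 hz
    have h2 := hupp z.1 hz
    simp only [hf]; split_ifs <;> linarith
  have hff' : ∀ z : Obs d, z.1 ∈ C → |f' z - f z| ≤ Δ := fun z hz => by
    have h1 := hΔ z.1 hz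
    simp only [hf, hf']
    split_ifs
    · exact h1
    · rwa [show 1 - η' z.1 - (1 - η z.1) = -(η' z.1 - η z.1) by ring, abs_neg]
  have hr0 : ∀ z, 0 ≤ r z := fun z => by
    simp only [hr]; split_ifs
    · exact div_nonneg (hf0' z) (hf0 z)
    · exact zero_le_one
  have hr4 : ∀ z, r z ≤ 4 := fun z => by
    simp only [hr]; split_ifs with hz
    · rw [div_le_iff₀ (by linarith [hfC z hz])]; linarith [hfC z hz, hf1' z]
    · norm_num
  have hrd : regMeasure Q η' = (regMeasure Q η).withDensity fun z => ENNReal.ofReal (r z) := by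
    rw [regMeasure, regMeasure, ← withDensity_mul _ hfm.ennreal_ofReal hrm.ennreal_ofReal]
    refine withDensity_congr_ae ?_
    filter_upwards [Measure.quasiMeasurePreserving_fst.ae heq] with z hz
    show ENNReal.ofReal (f' z) = ENNReal.ofReal (f z) * ENNReal.ofReal (r z)
    rw [← ENNReal.ofReal_mul (hf0 z)]
    congr 1
    by_cases hzC : z.1 ∈ C
    · have := hfC z hzC
      simp only [hr, hzC, if_true]
      field_simp
    · simp only [hr, hzC, if_false, hf, hf', hz hzC, mul_one]
  have hχ : ∫ z, (r z - 1) ^ 2 ∂(regMeasure Q η) ≤ 16 * Δ ^ 2 * Q.real C := by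
    have hle : ∀ z, (r z - 1) ^ 2 ≤ {z : Obs d | z.1 ∈ C}.indicator (fun _ => 16 * Δ ^ 2) z := by
      intro z
      by_cases hz : z.1 ∈ C
      · rw [Set.indicator_of_mem (show z ∈ {z : Obs d | z.1 ∈ C} from hz)]
        simp only [hr, hz, if_true]
        have h4 := hfC z hz
        rw [div_sub_one (by linarith), div_pow, div_le_iff₀ (by positivity)]
        have h5 : (f' z - f z) ^ 2 ≤ Δ ^ 2 := sq_le_sq' (by linarith [abs_le.mp (hff' z hz)])
          (by linarith [abs_le.mp (hff' z hz)])
        nlinarith [mul_le_mul_of_nonneg_left (mul_self_le_mul_self (by norm_num) h4)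
          (sq_nonneg Δ)]
      · rw [Set.indicator_of_notMem (show z ∉ {z : Obs d | z.1 ∈ C} from hz)]
        simp [hr, hz]
    calc _ ≤ ∫ z, {z : Obs d | z.1 ∈ C}.indicator (fun _ => 16 * Δ ^ 2) z ∂(regMeasure Q η) := by
          refine integral_mono_of_nonneg (ae_of_all _ fun z => sq_nonneg _)
            ((integrable_const _).indicator hCm) (ae_of_all _ hle)
      _ = _ := by
          rw [integral_indicator hCm, setIntegral_const, regMeasure_real_feature hη h01 hC,
            smul_eq_mul, mul_comm]
  have h1 : ∫ z, r z ∂(regMeasure Q η) = 1 := by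
    have hu1 : regMeasure Q η' Set.univ = 1 := measure_univ
    rw [hrd, withDensity_apply _ MeasurableSet.univ, Measure.restrict_univ] at hu1
    rw [integral_eq_lintegral_of_nonneg_ae (ae_of_all _ hr0) hrm.aestronglyMeasurable, hu1]
    simp
  have hui : Integrable u (sampleLaw n N (regMeasure Q η')) := by
    unfold sampleLaw
    rw [regMeasure_fst hη' h01']
    exact Integrable.of_mem_Icc 0 w hu.aemeasurable (ae_of_all _ fun z => ⟨hu0 z, huw z⟩)
  have hprob : IsProbabilityMeasure (sampleLaw n N (regMeasure Q η')) := by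
    unfold sampleLaw
    rw [regMeasure_fst hη' h01']
    infer_instance
  rw [integral_sub (integrable_const w) hui]
  have key : |∫ D, u D ∂(sampleLaw n N (regMeasure Q η')) -
      ∫ D, u D ∂(sampleLaw n N (regMeasure Q η))| ≤
      w * (1 / 4 + ((1 + 16 * Δ ^ 2 * Q.real C) ^ n - 1)) := by
    unfold sampleLaw
    -- Both laws have marginal `Q`, so the unlabelled sample is a common independent factor.
    rw [regMeasure_fst hη h01, regMeasure_fst hη' h01']
    rw [hrd] at hP' ⊢
    exact abs_integral_pi_withDensity_sub_le hrm hr0 hr4 h1 hχ hu hu0 huw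
  have hw : 0 ≤ w := by
    obtain ⟨D⟩ := (sampleLaw n N (regMeasure Q η')).nonempty_of_neZero
    exact (hu0 D).trans (huw D)
  have h2 : w * (1 / 4 + ((1 + 16 * Δ ^ 2 * Q.real C) ^ n - 1)) ≤ w * (1 / 2) := by
    gcongr
    linarith
  have h3 := abs_le.mp key
  simp only [integral_const, probReal_univ, smul_eq_mul, one_mul]
  linarith [h3.2]

theorem measurable_real_inter_ne {n N : ℕ} (g : ClassifierEstimator d n N) {C : Set (Feat d)}
    (hC : MeasurableSet C) (s : Fin 2) :
    Measurable fun D : SemiSample d n N => Q.real (C ∩ {x | g.1 D x ≠ s}) := by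
  have hE : MeasurableSet {z : SemiSample d n N × Feat d | z.2 ∈ C ∧ g.1 z.1 z.2 ≠ s} :=
    (measurable_snd hC).inter (g.2 (measurableSet_singleton s).compl)
  exact (measurable_measure_prodMk_left (ν := Q) hE).ennreal_toReal

theorem measurable_excessScore {n N : ℕ} (g : ClassifierEstimator d n N) (b : ℝ)
    (P : Measure (Obs d)) [SFinite P] :
    Measurable fun D : SemiSample d n N => excessScore b P (g.1 D) := by
  have hg : Measurable fun z : SemiSample d n N × Obs d => g.1 z.1 z.2.1 :=
    g.2.comp (measurable_fst.prodMk (measurable_fst.comp measurable_snd))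
  have h1 : MeasurableSet {z : SemiSample d n N × Obs d | z.2.2 = 1 ∧ g.1 z.1 z.2.1 = 1} :=
    ((measurable_snd.comp measurable_snd) (measurableSet_singleton 1)).inter
      (hg (measurableSet_singleton 1))
  have h2 : MeasurableSet {z : SemiSample d n N × Obs d | g.1 z.1 z.2.1 = 1} :=
    hg (measurableSet_singleton 1)
  unfold excessScore fScore
  exact measurable_const.sub ((measurable_measure_prodMk_left (ν := P) h1).ennreal_toReal.div
    (measurable_const.add (measurable_measure_prodMk_left (ν := P) h2).ennreal_toReal))

/-- Assouad's lemma for the excess score. -/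
theorem exists_le_expectedExcess {ι : Type*} [Fintype ι] [DecidableEq ι] {n N : ℕ}
    (g : ClassifierEstimator d n N) {η : (ι → Fin 2) → Feat d → ℝ} (hη : ∀ σ, Measurable (η σ))
    (h01 : ∀ σ x, η σ x ∈ Set.Icc (0 : ℝ) 1) {θ : ℝ} (hpos : ∀ σ, 0 < ∫ x, η σ x ∂Q)
    (hθ : ∀ σ, θ * ∫ x, η σ x ∂Q = ∫ x, max (η σ x - θ) 0 ∂Q)
    (T : Finset ι) (C : ι → Set (Feat d)) (hC : ∀ j ∈ T, MeasurableSet (C j))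
    (hdisj : ∀ i ∈ T, ∀ j ∈ T, i ≠ j → Disjoint (C i) (C j)) {w : ℝ}
    (hw : ∀ j ∈ T, Q.real (C j) = w) {h Δ : ℝ} (hh : 0 ≤ h)
    (h1 : ∀ σ, ∀ j ∈ T, σ j = 1 → ∀ x ∈ C j, h ≤ η σ x - θ)
    (h0 : ∀ σ, ∀ j ∈ T, σ j ≠ 1 → ∀ x ∈ C j, η σ x - θ ≤ -h)
    (heq : ∀ σ σ' : ι → Fin 2, ∀ j ∈ T, (∀ i, i ≠ j → σ i = σ' i) →
      ∀ᵐ x ∂Q, x ∉ C j → η σ x = η σ' x)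
    (hlow : ∀ σ, ∀ j ∈ T, ∀ x ∈ C j, 1 / 4 ≤ η σ x)
    (hupp : ∀ σ, ∀ j ∈ T, ∀ x ∈ C j, η σ x ≤ 3 / 4)
    (hΔ : ∀ σ σ', ∀ j ∈ T, ∀ x ∈ C j, |η σ' x - η σ x| ≤ Δ)
    (hn : (1 + 16 * Δ ^ 2 * w) ^ n ≤ 5 / 4) :
    ∃ σ, h / 2 * (T.card * (w / 4)) ≤ expectedExcess 1 (regMeasure Q (η σ)) g := by
  set u : ι → Fin 2 → SemiSample d n N → ℝ := fun j s D => Q.real (C j ∩ {x | g.1 D x ≠ s}) with hu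
  have hum : ∀ j ∈ T, ∀ s, Measurable (u j s) := fun j hj s => measurable_real_inter_ne g (hC j hj) s
  have hu0 : ∀ j s D, 0 ≤ u j s D := fun _ _ _ => measureReal_nonneg
  have huw : ∀ j ∈ T, ∀ s D, u j s D ≤ w := fun j hj s D => by
    rw [← hw j hj]
    exact measureReal_mono Set.inter_subset_left
  have hprob : ∀ σ, IsProbabilityMeasure (sampleLaw n N (regMeasure Q (η σ))) := fun σ => by
    have := isProbabilityMeasure_regMeasure (Q := Q) (hη σ) (h01 σ)
    unfold sampleLaw
    infer_instance
  have hgm : ∀ D, Measurable (g.1 D) := fun D => g.2.comp measurable_prodMk_left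
  have hui : ∀ σ, ∀ j ∈ T, ∀ s, Integrable (u j s) (sampleLaw n N (regMeasure Q (η σ))) :=
    fun σ j hj s => Integrable.of_mem_Icc 0 w (hum j hj s).aemeasurable
      (ae_of_all _ fun D => ⟨hu0 j s D, huw j hj s D⟩)
  have hcompl : ∀ j ∈ T, ∀ s s' : Fin 2, s ≠ s' → ∀ D, u j s' D = w - u j s D := by
    intro j hj s s' hs D
    have hm : MeasurableSet {x | g.1 D x ≠ s} := hgm D (measurableSet_singleton s).compl
    have := measureReal_inter_add_sdiff (μ := Q) (s := C j) hm
    have hset : C j \ {x | g.1 D x ≠ s} = C j ∩ {x | g.1 D x ≠ s'} := by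
      ext x
      have hx : g.1 D x = s ↔ g.1 D x ≠ s' := by omega
      simp [hx]
    rw [hset, hw j hj] at this
    simp only [hu]
    linarith
  have hlb : ∀ σ, h / 2 * ∑ j ∈ T, ∫ D, u j (σ j) D ∂(sampleLaw n N (regMeasure Q (η σ))) ≤
      expectedExcess 1 (regMeasure Q (η σ)) g := by
    intro σ
    have := isProbabilityMeasure_regMeasure (Q := Q) (hη σ) (h01 σ)
    rw [← integral_finsetSum _ fun j hj => hui σ j hj (σ j), ← integral_const_mul]
    refine integral_mono ((integrable_finsetSum _ fun j hj => hui σ j hj (σ j)).const_mul _)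
      (Integrable.of_mem_Icc 0 1 (measurable_excessScore g 1 _).aemeasurable (ae_of_all _ fun D =>
        excessScore_regMeasure_mem_Icc (hη σ) (h01 σ) (hgm D))) fun D => ?_
    exact sum_le_excessScore_regMeasure (hη σ) (h01 σ) (hpos σ) (hθ σ) (hgm D) T C hC hdisj σ
      (h1 σ) (h0 σ)
  have hbit : ∀ j ∈ T, (Fintype.card (ι → Fin 2) : ℝ) * (w / 4) ≤
      ∑ σ, ∫ D, u j (σ j) D ∂(sampleLaw n N (regMeasure Q (η σ))) := by
    intro j hj
    -- Each vertex is paired with its neighbour across bit `j`. As flipping is an involution,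
    -- summing the pair bound over all vertices counts the total error at `j` twice.
    set flip : (ι → Fin 2) → (ι → Fin 2) := fun σ => Function.update σ j (1 - σ j) with hflip
    have hinv : Function.Involutive flip := fun σ => by
      ext i
      by_cases hi : i = j
      · subst hi; simp [hflip]
      · simp [hflip, hi]
    have hsum := Equiv.sum_comp (hinv.toPerm flip)
      fun σ => ∫ D, u j (σ j) D ∂(sampleLaw n N (regMeasure Q (η σ)))
    have hpair : ∀ σ, w / 2 ≤ ∫ D, u j (σ j) D ∂(sampleLaw n N (regMeasure Q (η σ))) +
        ∫ D, u j (flip σ j) D ∂(sampleLaw n N (regMeasure Q (η (flip σ)))) := by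
      intro σ
      have hne : σ j ≠ flip σ j := by
        simp only [hflip, Function.update_self]
        generalize σ j = s
        revert s; decide
      -- With two labels, `g` errs for one bit value exactly where it is right for the other, so the
      -- two losses add up to `w`.
      simp_rw [hcompl j hj _ _ hne]
      refine half_le_integral_add_integral (hη σ) (hη _) (h01 σ) (h01 _) (hC j hj)
        (heq σ _ j hj fun i hi => by simp [hflip, hi]) (hlow σ j hj) (hupp σ j hj) (hΔ σ _ j hj)
        (by rw [hw j hj]; exact hn) (hum j hj _) (hu0 j _) (huw j hj _)
    have h2 := Finset.sum_le_sum fun σ (_ : σ ∈ Finset.univ) => hpair σ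
    rw [Finset.sum_add_distrib, Finset.sum_const, nsmul_eq_mul, Finset.card_univ] at h2
    have h3 : ∑ σ, ∫ D, u j (flip σ j) D ∂(sampleLaw n N (regMeasure Q (η (flip σ)))) =
        ∑ σ, ∫ D, u j (σ j) D ∂(sampleLaw n N (regMeasure Q (η σ))) := hsum
    linarith
  have htot : ∑ _σ : ι → Fin 2, h / 2 * (T.card * (w / 4)) ≤
      ∑ σ, expectedExcess 1 (regMeasure Q (η σ)) g := by
    refine le_trans ?_ (Finset.sum_le_sum fun σ _ => hlb σ)
    have e : ∑ σ, h / 2 * ∑ j ∈ T, ∫ D, u j (σ j) D ∂(sampleLaw n N (regMeasure Q (η σ))) =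
        h / 2 * ∑ j ∈ T, ∑ σ, ∫ D, u j (σ j) D ∂(sampleLaw n N (regMeasure Q (η σ))) := by
      rw [← Finset.mul_sum, Finset.sum_comm]
    rw [e, Finset.sum_const, nsmul_eq_mul, Finset.card_univ]
    have := Finset.sum_le_sum hbit
    rw [Finset.sum_const, nsmul_eq_mul] at this
    calc _ = h / 2 * (T.card * ((Fintype.card (ι → Fin 2) : ℝ) * (w / 4))) := by ring
      _ ≤ _ := by gcongr
  obtain ⟨σ, _, hσ⟩ := Finset.exists_le_of_sum_le Finset.univ_nonempty htot
  exact ⟨σ, hσ⟩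

end Assouad

/-! ### Regular sets: products, unions and the comb. -/

/-- A product set in Euclidean space. -/
def prodSet {d : ℕ} (S : Fin d → Set ℝ) : Set (Feat d) := {x | ∀ i, x i ∈ S i}

section ProdSet

variable {d : ℕ} {S : Fin d → Set ℝ}

theorem mem_prodSet {x : Feat d} : x ∈ prodSet S ↔ ∀ i, x i ∈ S i := Iff.rfl

theorem prodSet_eq_preimage : prodSet S = WithLp.ofLp (p := 2) ⁻¹' (Set.univ.pi S) := by
  ext x; simp [prodSet]

theorem measurableSet_prodSet (hS : ∀ i, MeasurableSet (S i)) : MeasurableSet (prodSet S) := by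
  rw [prodSet_eq_preimage]
  exact (PiLp.volume_preserving_ofLp (Fin d)).measurable (MeasurableSet.univ_pi hS)

theorem volume_prodSet (hS : ∀ i, MeasurableSet (S i)) :
    volume (prodSet S) = ∏ i, volume (S i) := by
  rw [prodSet_eq_preimage, (PiLp.volume_preserving_ofLp (Fin d)).measure_preimage
    (MeasurableSet.univ_pi hS).nullMeasurableSet, volume_pi_pi]

theorem isCompact_prodSet (hS : ∀ i, IsCompact (S i)) : IsCompact (prodSet S) := by
  rw [prodSet_eq_preimage]
  exact (EuclideanSpace.equiv (Fin d) ℝ).toHomeomorph.isCompact_preimage.mpr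
    (isCompact_univ_pi hS)

/-- A product of sets with lower density bounds on the line is regular. -/
theorem isRegularSet_prodSet (hd : 0 < d) (hS : ∀ i, MeasurableSet (S i)) {c s₀ : ℝ} (hc : 0 ≤ c)
    (hreg : ∀ i, ∀ t ∈ S i, ∀ s, 0 < s → s ≤ s₀ →
      ENNReal.ofReal (c * s) ≤ volume (S i ∩ Set.Ioo (t - s) (t + s))) :
    IsRegularSet ((c / (2 * d)) ^ d) s₀ (prodSet S) := by
  have hd1 : (1 : ℝ) ≤ d := by exact_mod_cast hd
  refine ⟨(measurableSet_prodSet hS).nullMeasurableSet, fun x hx r hr hrs => ?_⟩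
  -- The cube of half-side `r / d` lies in the ball of radius `r`, which lies in the cube of
  -- half-side `r`; the ratio of the resulting bounds is `(c * s) ^ d / (2 * r) ^ d`.
  set s := r / d with hs
  have hs0 : 0 < s := by positivity
  have hsr : s ≤ r := div_le_self hr.le hd1
  have hsub : prodSet (fun i => S i ∩ Set.Ioo (x i - s) (x i + s)) ⊆
      prodSet S ∩ Metric.ball x r := by
    intro y hy
    refine ⟨fun i => (hy i).1, ?_⟩
    rw [mem_ball_iff_norm, EuclideanSpace.norm_eq, Real.sqrt_lt' hr]
    have h1 : ∀ i ∈ Finset.univ, ‖(y - x) i‖ ^ 2 < s ^ 2 := fun i _ => by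
      rw [Real.norm_eq_abs, sq_abs]
      have h2 := (hy i).2
      refine sq_lt_sq' ?_ ?_ <;> simp <;> linarith [h2.1, h2.2]
    have hne : (Finset.univ : Finset (Fin d)).Nonempty := ⟨⟨0, hd⟩, Finset.mem_univ _⟩
    calc ∑ i, ‖(y - x) i‖ ^ 2 < ∑ _i : Fin d, s ^ 2 := Finset.sum_lt_sum_of_nonempty hne h1
      _ = d * s ^ 2 := by simp
      _ ≤ d * (d * s ^ 2) := le_mul_of_one_le_left (by positivity) hd1
      _ = r ^ 2 := by rw [hs]; field_simp
  have hball : Metric.ball x r ⊆ prodSet fun i => Set.Ioo (x i - r) (x i + r) := by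
    intro y hy i
    rw [mem_ball_iff_norm] at hy
    have := (PiLp.norm_apply_le (y - x) i).trans_lt hy
    rw [Real.norm_eq_abs, abs_lt] at this
    simp only [PiLp.sub_apply] at this
    constructor <;> linarith [this.1, this.2]
  have hup : volume.real (Metric.ball x r) ≤ (2 * r) ^ d := by
    refine (measureReal_mono hball ?_).trans (le_of_eq ?_)
    · rw [volume_prodSet fun i => measurableSet_Ioo]
      exact ENNReal.prod_ne_top fun i _ => by simp
    · rw [Measure.real, volume_prodSet fun i => measurableSet_Ioo]
      simp only [Real.volume_Ioo]
      rw [Finset.prod_congr rfl fun i _ =>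
        show ENNReal.ofReal (x i + r - (x i - r)) = ENNReal.ofReal (2 * r) by congr 1; ring]
      simp [ENNReal.toReal_pow, ENNReal.toReal_ofReal, hr.le]
  have hlow : (c * s) ^ d ≤ volume.real (prodSet S ∩ Metric.ball x r) := by
    have h3 : ENNReal.ofReal ((c * s) ^ d) ≤ volume (prodSet S ∩ Metric.ball x r) := by
      refine le_trans ?_ (measure_mono hsub)
      rw [volume_prodSet fun i => (hS i).inter measurableSet_Ioo, ENNReal.ofReal_pow (by positivity)]
      calc ENNReal.ofReal (c * s) ^ d = ∏ _i : Fin d, ENNReal.ofReal (c * s) := by simp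
        _ ≤ _ := Finset.prod_le_prod' fun i _ => hreg i _ (hx i) s hs0 (hsr.trans hrs)
    rw [← ENNReal.toReal_ofReal (by positivity : 0 ≤ (c * s) ^ d)]
    refine ENNReal.toReal_mono ?_ h3
    exact ne_top_of_le_ne_top measure_ball_lt_top.ne (measure_mono Set.inter_subset_right)
  calc (c / (2 * d)) ^ d * volume.real (Metric.ball x r) ≤ (c / (2 * d)) ^ d * (2 * r) ^ d := by
        gcongr
    _ = (c * s) ^ d := by rw [← mul_pow, hs]; congr 1; field_simp
    _ ≤ _ := hlow

end ProdSet

theorem IsRegularSet.union {d : ℕ} {c r : ℝ} {A B : Set (Feat d)} (hA : IsRegularSet c r A)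
    (hB : IsRegularSet c r B) : IsRegularSet c r (A ∪ B) := by
  refine ⟨hA.1.union hB.1, fun x hx s hs hsr => ?_⟩
  have hfin : volume ((A ∪ B) ∩ Metric.ball x s) ≠ ⊤ :=
    ne_top_of_le_ne_top measure_ball_lt_top.ne (measure_mono Set.inter_subset_right)
  rcases hx with hx | hx
  · exact (hA.2 x hx s hs hsr).trans (measureReal_mono (by gcongr; exact Set.subset_union_left) hfin)
  · exact (hB.2 x hx s hs hsr).trans (measureReal_mono (by gcongr; exact Set.subset_union_right) hfin)

theorem IsRegularSet.mono {d : ℕ} {c c' r r' : ℝ} {A : Set (Feat d)} (hA : IsRegularSet c r A)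
    (hc : c' ≤ c) (hr : r' ≤ r) : IsRegularSet c' r' A :=
  ⟨hA.1, fun x hx s hs hsr => (by gcongr : _ ≤ _).trans (hA.2 x hx s hs (hsr.trans hr))⟩

/-- An interval has lower density at least `1/2` at its points. -/
theorem ofReal_le_volume_Icc_inter_Ioo {u v t c s : ℝ} (ht : t ∈ Set.Icc u v)
    (hs : 0 ≤ s) (hc : c ≤ 1) (hc0 : 0 ≤ c) (hcs : c * s ≤ (v - u) / 2) :
    ENNReal.ofReal (c * s) ≤ volume (Set.Icc u v ∩ Set.Ioo (t - s) (t + s)) := by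
  have h1 : c * s ≤ s := mul_le_of_le_one_left hs hc
  have h2 : 0 ≤ c * s := by positivity
  -- Moving from `t` towards the midpoint, a segment of length `c * s` stays in the interval.
  rcases le_total t ((u + v) / 2) with h | h
  · calc ENNReal.ofReal (c * s) = volume (Set.Ioo t (t + c * s)) := by simp
      _ ≤ _ := measure_mono fun y hy => by
        have := ht.1
        exact ⟨⟨by linarith [hy.1], by linarith [hy.2]⟩, by linarith [hy.1], by linarith [hy.2]⟩
  · calc ENNReal.ofReal (c * s) = volume (Set.Ioo (t - c * s) t) := by simp
      _ ≤ _ := measure_mono fun y hy => by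
        have := ht.2
        exact ⟨⟨by linarith [hy.1], by linarith [hy.2]⟩, by linarith [hy.1], by linarith [hy.2]⟩

/-- The comb: the first `ρ`-th part of each of the `q` subintervals of `[0, 1]` of length `1/q`. -/
def comb (q : ℕ) (ρ : ℝ) : Set ℝ := ⋃ k : Fin q, Set.Icc ((k : ℕ) / (q : ℝ)) (((k : ℕ) + ρ) / q)

theorem isCompact_comb (q : ℕ) (ρ : ℝ) : IsCompact (comb q ρ) :=
  isCompact_iUnion fun _ => isCompact_Icc

theorem volume_comb {q : ℕ} (hq : 0 < q) {ρ : ℝ} (hρ : ρ < 1) :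
    volume (comb q ρ) = ENNReal.ofReal ρ := by
  have hq' : (0 : ℝ) < q := by exact_mod_cast hq
  rw [comb, measure_iUnion, tsum_fintype]
  · simp only [Real.volume_Icc]
    rw [Finset.sum_congr rfl fun k _ => show ENNReal.ofReal ((((k : Fin q) : ℕ) + ρ) / (q : ℝ) -
      ((k : ℕ) : ℝ) / q) = ENNReal.ofReal (ρ / q) by congr 1; ring]
    rw [Finset.sum_const, Finset.card_univ, Fintype.card_fin, nsmul_eq_mul,
      ← ENNReal.ofReal_natCast, ← ENNReal.ofReal_mul hq'.le]
    congr 1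
    field_simp
  · intro k l hkl
    have key : ∀ k l : Fin q, k < l → Disjoint (Set.Icc ((k : ℕ) / (q : ℝ)) (((k : ℕ) + ρ) / q))
        (Set.Icc ((l : ℕ) / (q : ℝ)) (((l : ℕ) + ρ) / q)) := by
      intro k l hkl
      rw [Set.disjoint_left]
      intro y hy hy'
      have h1 : ((k : ℕ) : ℝ) + 1 ≤ (l : ℕ) := by exact_mod_cast hkl
      have h2 := hy'.1.trans hy.2
      rw [div_le_div_iff_of_pos_right hq'] at h2
      linarith
    rcases lt_or_gt_of_ne hkl with h | h
    · exact key k l h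
    · exact (key l k h).symm
  · exact fun _ => measurableSet_Icc

theorem ofReal_le_volume_comb_inter {q : ℕ} (hq : 0 < q) {ρ : ℝ} (hρ : ρ ≤ 1)
    {j m : ℕ} (hjm : j + m ≤ q) :
    ENNReal.ofReal (m * (ρ / q)) ≤
      volume (comb q ρ ∩ Set.Ioo ((j : ℝ) / q) (((j + m : ℕ) : ℝ) / q)) := by
  have hq' : (0 : ℝ) < q := by exact_mod_cast hq
  set I : ℕ → Set ℝ := fun i => Set.Ioo ((i : ℝ) / q) ((i + ρ) / q) with hI
  have hdisj : Set.PairwiseDisjoint (Finset.Ico j (j + m) : Set ℕ) I := by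
    have key : ∀ k l : ℕ, k < l → Disjoint (I k) (I l) := by
      intro k l hkl
      rw [Set.disjoint_left]
      intro y hy hy'
      have h1 : (k : ℝ) + 1 ≤ l := by exact_mod_cast hkl
      have h2 := hy'.1.trans hy.2
      rw [div_lt_div_iff_of_pos_right hq'] at h2
      linarith
    intro k _ l _ hkl
    rcases lt_or_gt_of_ne hkl with h | h
    · exact key k l h
    · exact (key l k h).symm
  calc ENNReal.ofReal (m * (ρ / q)) = ∑ i ∈ Finset.Ico j (j + m), volume (I i) := by
        simp only [hI, Real.volume_Ioo]
        rw [Finset.sum_congr rfl fun (i : ℕ) _ => show ENNReal.ofReal (((i : ℝ) + ρ) / q - (i : ℝ) / q) =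
          ENNReal.ofReal (ρ / q) by congr 1; ring]
        rw [Finset.sum_const, Nat.card_Ico, nsmul_eq_mul, ENNReal.ofReal_mul (by positivity)]
        simp
    _ = volume (⋃ i ∈ Finset.Ico j (j + m), I i) :=
        (measure_biUnion_finset hdisj fun _ _ => measurableSet_Ioo).symm
    _ ≤ _ := by
        refine measure_mono (Set.iUnion₂_subset fun i hi y hy => ?_)
        rw [Finset.mem_Ico] at hi
        refine ⟨Set.mem_iUnion.mpr ⟨⟨i, by omega⟩, hy.1.le, hy.2.le⟩, ?_, ?_⟩
        · refine lt_of_le_of_lt ?_ hy.1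
          gcongr
          exact_mod_cast hi.1
        · refine hy.2.trans_le ?_
          have : (i : ℝ) + 1 ≤ (j + m : ℕ) := by exact_mod_cast hi.2
          gcongr
          linarith

/-- The lower density of the comb does not depend on the number of its teeth. -/
theorem ofReal_le_volume_comb_inter_Ioo {q : ℕ} (hq : 0 < q) {ρ : ℝ} (hρ0 : 0 ≤ ρ) (hρ : ρ ≤ 1)
    {t : ℝ} (ht : t ∈ comb q ρ) {s : ℝ} (hs : 0 < s) (hs2 : s ≤ 1 / 2) :
    ENNReal.ofReal (ρ / 4 * s) ≤ volume (comb q ρ ∩ Set.Ioo (t - s) (t + s)) := by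
  have hq' : (0 : ℝ) < q := by exact_mod_cast hq
  obtain ⟨k, hk⟩ := Set.mem_iUnion.mp ht
  have hk1 : ((k : ℕ) : ℝ) ≤ t * q := (div_le_iff₀ hq').mp hk.1
  have hk2 : t * q ≤ (k : ℕ) + ρ := (le_div_iff₀ hq').mp hk.2
  -- At scales up to two periods the tooth containing `t` suffices: half its length is `ρ / (2 * q)
  -- ≥ ρ / 4 * s`. At larger scales whole teeth are counted.
  rcases le_or_gt (s * q) 2 with hsq | hsq
  · refine (ofReal_le_volume_Icc_inter_Ioo hk hs.le (by linarith) (by positivity) ?_).trans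
      (measure_mono (Set.inter_subset_inter_left _ (Set.subset_iUnion
        (fun k : Fin q => Set.Icc ((k : ℕ) / (q : ℝ)) (((k : ℕ) + ρ) / q)) k)))
    rw [← sub_div, add_sub_cancel_left, div_div, le_div_iff₀ (by positivity)]
    nlinarith
  · set M := ⌊s * q⌋₊ with hM
    have hM1 : (M : ℝ) ≤ s * q := Nat.floor_le (by positivity)
    have hM2 : s * q < M + 1 := Nat.lt_floor_add_one _
    have hM3 : 2 ≤ M := Nat.le_floor (by exact_mod_cast hsq.le)
    -- One period is given up because `t` may lie inside its tooth. Since `m ≥ 1` and `s * q < m +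
    -- 2`, still `m ≥ s * q / 4`.
    obtain ⟨m, hm⟩ : ∃ m, M = m + 1 := ⟨M - 1, by omega⟩
    have hmR : (M : ℝ) = m + 1 := by exact_mod_cast hm
    have hm1 : (1 : ℝ) ≤ m := by exact_mod_cast (by omega : 1 ≤ m)
    have hgoal : ∀ j : ℕ, j + m ≤ q → (t - s) * q ≤ j → ((j + m : ℕ) : ℝ) ≤ (t + s) * q →
        ENNReal.ofReal (ρ / 4 * s) ≤ volume (comb q ρ ∩ Set.Ioo (t - s) (t + s)) := by
      intro j hj h1 h2
      refine le_trans (ENNReal.ofReal_le_ofReal ?_) ((ofReal_le_volume_comb_inter hq hρ hj).trans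
        (measure_mono (Set.inter_subset_inter_right _ (Set.Ioo_subset_Ioo
          ((le_div_iff₀ hq').mpr h1) ((div_le_iff₀ hq').mpr h2)))))
      rw [← mul_div_assoc, le_div_iff₀ hq']
      nlinarith
    -- The full periods are taken on the side with more room; `s ≤ 1/2` keeps them inside `[0, 1]`.
    rcases le_total t (1 / 2) with h | h
    · have hkM : (k : ℕ) + 1 + m ≤ q := by
        have : ((k : ℕ) : ℝ) + M ≤ q := by nlinarith
        have : (k : ℕ) + M ≤ q := by exact_mod_cast this
        omega
      refine hgoal (k + 1) hkM ?_ ?_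
      · push_cast; nlinarith
      · push_cast; nlinarith
    · have hkM : M ≤ (k : ℕ) + 1 := by
        have : (M : ℝ) ≤ (k : ℕ) + 1 := by nlinarith
        exact_mod_cast this
      refine hgoal ((k : ℕ) + 1 - M) (by have := k.2; omega) ?_ ?_
      · rw [Nat.cast_sub hkM]; push_cast; nlinarith
      · rw [hm, show (k : ℕ) + 1 - (m + 1) + m = k by omega]
        nlinarith

/-! ### The design and the perturbed regression functions. -/

/-- The grid cell of the comb product with index `J`. -/
def toothCell {d q : ℕ} (ρ : ℝ) (J : Fin d → Fin q) : Set (Feat d) :=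
  prodSet fun i => Set.Icc ((J i : ℕ) / (q : ℝ)) (((J i : ℕ) + ρ) / q)

/-- A cube far away from the comb. -/
def farCube (d : ℕ) (R a : ℝ) : Set (Feat d) := prodSet fun _ => Set.Icc R (R + a)

/-- The support of the design: a product of combs together with a cube. -/
def designSet (d q : ℕ) (ρ R a : ℝ) : Set (Feat d) :=
  prodSet (fun _ => comb q ρ) ∪ farCube d R a

/-- The measure with constant density `μ` on the design set. -/
def designMeasure (d q : ℕ) (ρ R a μ : ℝ) : Measure (Feat d) :=
  volume.withDensity fun x => ENNReal.ofReal ((designSet d q ρ R a).indicator (fun _ => μ) x)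

/-- The regression function with value about `θ` near the comb and `η₁` on the cube, perturbed by
`b` times a combination of bumps. -/
def regFun {d q : ℕ} (θ η₁ R b : ℝ) (T : Finset (Fin d → Fin q)) (a : (Fin d → Fin q) → ℝ)
    (x : Feat d) : ℝ :=
  η₁ - (η₁ - θ) * unitBump d (R⁻¹ • x) + b * bumpSum T a ((q : ℝ) • x)

section Values

variable {d q : ℕ} {ρ R b θ η₁ l : ℝ} {T : Finset (Fin d → Fin q)} {a : (Fin d → Fin q) → ℝ}

theorem comb_prod_eq_iUnion :
    prodSet (fun _ : Fin d => comb q ρ) = ⋃ J : Fin d → Fin q, toothCell ρ J := by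
  ext x
  simp only [mem_prodSet, comb, Set.mem_iUnion, toothCell]
  exact Classical.skolem

theorem measurableSet_toothCell (J : Fin d → Fin q) : MeasurableSet (toothCell ρ J) :=
  measurableSet_prodSet fun _ => measurableSet_Icc

theorem measurableSet_farCube : MeasurableSet (farCube d R l) :=
  measurableSet_prodSet fun _ => measurableSet_Icc

theorem isCompact_designSet : IsCompact (designSet d q ρ R l) :=
  (isCompact_prodSet fun _ => isCompact_comb q ρ).union (isCompact_prodSet fun _ => isCompact_Icc)

theorem norm_le_of_forall_abs_le {x : Feat d} {t : ℝ} (ht : 0 ≤ t) (h : ∀ i, |x i| ≤ t) :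
    ‖x‖ ≤ d * t := by
  rw [EuclideanSpace.norm_eq, Real.sqrt_le_left (by positivity)]
  calc ∑ i, ‖x i‖ ^ 2 ≤ ∑ _i : Fin d, t ^ 2 := Finset.sum_le_sum fun i _ => by
        gcongr; exact h i
    _ = d * t ^ 2 := by simp
    _ ≤ (d * t) ^ 2 := by
        rw [mul_pow]
        gcongr
        rcases Nat.eq_zero_or_pos d with h0 | h0
        · simp [h0]
        · exact le_self_pow₀ (by exact_mod_cast h0) two_ne_zero

theorem norm_latticePt_le (J : Fin d → Fin q) : ‖latticePt J‖ ≤ d * q :=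
  norm_le_of_forall_abs_le (by positivity) fun i => by
    simp only [latticePt, Nat.abs_cast]
    exact_mod_cast (J i).2.le

/-- Points near a lattice point lie where the large bump equals one. -/
theorem unitBump_smul_eq_one (hq : 0 < q) (hR : 4 * (d + 1) ≤ R) {x : Feat d} {J : Fin d → Fin q}
    (hx : ‖(q : ℝ) • x - latticePt J‖ ≤ 1) : unitBump d (R⁻¹ • x) = 1 := by
  have hq1 : (1 : ℝ) ≤ q := by exact_mod_cast hq
  have hR0 : 0 < R := by nlinarith [(d.cast_nonneg : (0 : ℝ) ≤ d)]
  have h1 : ‖(q : ℝ) • x‖ ≤ d * q + 1 := by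
    have h2 := norm_add_le ((q : ℝ) • x - latticePt J) (latticePt J)
    rw [sub_add_cancel] at h2
    linarith [norm_latticePt_le J]
  rw [norm_smul, Real.norm_of_nonneg (by positivity)] at h1
  refine unitBump_eq_one ?_
  rw [norm_smul, Real.norm_of_nonneg (by positivity), inv_mul_le_iff₀ hR0]
  have h3 : ‖x‖ ≤ d + 1 := by
    by_contra hc
    push Not at hc
    nlinarith
  linarith

/-- After dilation by `q` a cell lies within the plateau of its bump. Hence `η` is exactly constant
on each cell, and all transitions take place in gaps without mass. -/
theorem norm_smul_sub_latticePt_le (hq : 0 < q) (hρ0 : 0 ≤ ρ) (hρ : d * ρ ≤ 1 / 4) {x : Feat d}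
    {J : Fin d → Fin q} (hx : x ∈ toothCell ρ J) : ‖(q : ℝ) • x - latticePt J‖ ≤ 1 / 4 := by
  have hq' : (0 : ℝ) < q := by exact_mod_cast hq
  refine (norm_le_of_forall_abs_le hρ0 fun i => ?_).trans hρ
  have h1 := (div_le_iff₀ hq').mp (hx i).1
  have h2 := (le_div_iff₀ hq').mp (hx i).2
  simp only [latticePt, PiLp.sub_apply, PiLp.smul_apply, smul_eq_mul]
  rw [abs_le]
  constructor <;> linarith

theorem regFun_of_mem_toothCell (hq : 0 < q) (hρ0 : 0 ≤ ρ) (hρ : d * ρ ≤ 1 / 4)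
    (hR : 4 * (d + 1) ≤ R) {x : Feat d} {J : Fin d → Fin q} (hx : x ∈ toothCell ρ J) (hJ : J ∈ T) :
    regFun θ η₁ R b T a x = θ + b * a J := by
  have h1 := norm_smul_sub_latticePt_le hq hρ0 hρ hx
  rw [regFun, unitBump_smul_eq_one hq hR (h1.trans (by norm_num)),
    bumpSum_eq hJ (by linarith), unitBump_eq_one h1]
  ring

theorem regFun_of_mem_toothCell_of_notMem (hq : 0 < q) (hρ0 : 0 ≤ ρ) (hρ : d * ρ ≤ 1 / 4)
    (hR : 4 * (d + 1) ≤ R) {x : Feat d} {J : Fin d → Fin q} (hx : x ∈ toothCell ρ J) (hJ : J ∉ T) :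
    regFun θ η₁ R b T a x = θ := by
  have h1 := norm_smul_sub_latticePt_le hq hρ0 hρ hx
  rw [regFun, unitBump_smul_eq_one hq hR (h1.trans (by norm_num)), bumpSum_eq_zero fun K hK => ?_]
  · ring
  · by_contra hc
    push Not at hc
    have := latticePt_eq_of_norm_lt (x := (q : ℝ) • x) (J := J) (K := K) (by linarith) (by linarith)
    exact hJ (this ▸ hK)

theorem regFun_of_mem_farCube (hd : 0 < d) (hq : 0 < q) (hR : 4 * (d + 1) ≤ R) {x : Feat d}
    (hx : x ∈ farCube d R l) : regFun θ η₁ R b T a x = η₁ := by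
  have hq1 : (1 : ℝ) ≤ q := by exact_mod_cast hq
  have hR4 : 4 ≤ R := by nlinarith [(d.cast_nonneg : (0 : ℝ) ≤ d)]
  have hx0 := (hx ⟨0, hd⟩).1
  have hxn : R ≤ ‖x‖ := by
    refine hx0.trans ((le_abs_self _).trans ?_)
    simpa using PiLp.norm_apply_le x ⟨0, hd⟩
  rw [regFun, unitBump_eq_zero, bumpSum_eq_zero fun J _ => ?_]
  · ring
  · have h1 := PiLp.norm_apply_le ((q : ℝ) • x - latticePt J) ⟨0, hd⟩
    have h2 : ((J ⟨0, hd⟩ : ℕ) : ℝ) ≤ q := by exact_mod_cast (J ⟨0, hd⟩).2.le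
    refine le_trans ?_ h1
    simp only [latticePt, PiLp.sub_apply, PiLp.smul_apply, smul_eq_mul]
    refine le_trans ?_ (le_abs_self _)
    nlinarith
  · rw [norm_smul, Real.norm_of_nonneg (by positivity), le_inv_mul_iff₀ (by positivity)]
    linarith

/-- The two kinds of bump never interfere: where a small one is active the large one equals 1 and
the value is within `b` of `θ`; elsewhere it is a convex combination of `θ` and `η₁`. -/
theorem regFun_mem_Icc (hq : 0 < q) (hR : 4 * (d + 1) ≤ R) (hb : 0 ≤ b) (hbθ : b ≤ θ)
    (hbθ' : θ + b ≤ 1) (hη₁ : η₁ ∈ Set.Icc (0 : ℝ) 1) (ha : ∀ J, |a J| ≤ 1) (x : Feat d) :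
    regFun θ η₁ R b T a x ∈ Set.Icc (0 : ℝ) 1 := by
  by_cases hex : ∃ J ∈ T, ‖(q : ℝ) • x - latticePt J‖ < 1 / 3
  · obtain ⟨J, hJ, hx⟩ := hex
    rw [regFun, unitBump_smul_eq_one hq hR (hx.le.trans (by norm_num)), bumpSum_eq hJ (by linarith)]
    have h1 : |b * (a J * unitBump d ((q : ℝ) • x - latticePt J))| ≤ b := by
      rw [abs_mul, abs_mul, abs_of_nonneg hb, abs_of_nonneg (unitBump d).nonneg]
      exact mul_le_of_le_one_right hb
        (mul_le_one₀ (ha J) (unitBump d).nonneg (unitBump d).le_one)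
    have h2 := abs_le.mp h1
    constructor <;> linarith [h2.1, h2.2]
  · push Not at hex
    rw [regFun, bumpSum_eq_zero hex]
    have h0 := (unitBump d).nonneg (x := R⁻¹ • x)
    have h1 := (unitBump d).le_one (x := R⁻¹ • x)
    have := hη₁.1
    have := hη₁.2
    constructor <;> nlinarith

theorem continuous_regFun : Continuous (regFun θ η₁ R b T a) := by
  unfold regFun bumpSum
  have h := (unitBump d).continuous
  fun_prop

/-- Half of `L` is spent on the wide transition from comb to cube, made flat by a large `R`; the
other half on the narrow bumps, whose factor `q ^ β` the height `b` must absorb. -/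
theorem isHolder_regFun {β L L₀ : ℝ} (hq : 0 < q) (hR : 4 * (d + 1) ≤ R) (hb : 0 ≤ b)
    (hbθ : b ≤ θ) (hbθ' : θ + b ≤ 1) (hη₁ : η₁ ∈ Set.Icc (0 : ℝ) 1) (ha : ∀ J, |a J| ≤ 1)
    (hL₀ : 0 ≤ L₀) (h1 : HasTaylorBound β L₀ (unitBump d)) (h2 : HasTaylorBound β L₀ (bumpSum T a))
    (hRL : L₀ * R⁻¹ ^ β ≤ L / 2) (hbL : b * (L₀ * (q : ℝ) ^ β) ≤ L / 2) :
    IsHolder β L (regFun θ η₁ R b T a) := by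
  have hR0 : 0 < R := by nlinarith [(d.cast_nonneg : (0 : ℝ) ≤ d)]
  have H := ((HasTaylorBound.const η₁ β).add
    ((h1.comp_smul (inv_nonneg.mpr hR0.le)).const_mul (-(η₁ - θ)))).add
    ((h2.comp_smul (Nat.cast_nonneg q)).const_mul b)
  have e : regFun θ η₁ R b T a = fun x => η₁ + -(η₁ - θ) * unitBump d (R⁻¹ • x) +
      b * bumpSum T a ((q : ℝ) • x) := by
    ext x; rw [regFun]; ring
  rw [← e] at H
  have hL : 0 + |-(η₁ - θ)| * (L₀ * R⁻¹ ^ β) + |b| * (L₀ * (q : ℝ) ^ β) ≤ L := by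
    have : |-(η₁ - θ)| ≤ 1 := by
      rw [abs_le]; constructor <;> linarith [hη₁.1, hη₁.2]
    have : |-(η₁ - θ)| * (L₀ * R⁻¹ ^ β) ≤ 1 * (L₀ * R⁻¹ ^ β) := by gcongr
    rw [abs_of_nonneg hb]
    linarith
  have H' := H.mono hL
  exact ⟨regFun_mem_Icc hq hR hb hbθ hbθ' hη₁ ha, H'.1, H'.2⟩

end Values

section Design

variable {d q : ℕ} {ρ R b θ η₁ l μ : ℝ} {T : Finset (Fin d → Fin q)} {a : (Fin d → Fin q) → ℝ}

theorem measurableSet_designSet : MeasurableSet (designSet d q ρ R l) :=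
  isCompact_designSet.measurableSet

theorem designMeasure_apply {E : Set (Feat d)} (hE : MeasurableSet E) :
    designMeasure d q ρ R l μ E = ENNReal.ofReal μ * volume (designSet d q ρ R l ∩ E) := by
  have e : (fun x => ENNReal.ofReal ((designSet d q ρ R l).indicator (fun _ => μ) x)) =
      (designSet d q ρ R l).indicator fun _ => ENNReal.ofReal μ := by
    ext x
    by_cases hx : x ∈ designSet d q ρ R l <;> simp [hx]
  rw [designMeasure, withDensity_apply _ hE, e, lintegral_indicator measurableSet_designSet,
    Measure.restrict_restrict measurableSet_designSet, lintegral_const, Measure.restrict_apply_univ]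

theorem ae_mem_designSet :
    ∀ᵐ x ∂(designMeasure d q ρ R l μ), x ∈ designSet d q ρ R l := by
  rw [ae_iff]
  have := designMeasure_apply (d := d) (q := q) (ρ := ρ) (R := R) (l := l) (μ := μ)
    (measurableSet_designSet (d := d) (q := q) (ρ := ρ) (R := R) (l := l)).compl
  rw [Set.inter_compl_self, measure_empty, mul_zero] at this
  exact this

theorem designMeasure_real_toothCell (hμ : 0 ≤ μ) (hρ : 0 ≤ ρ) (J : Fin d → Fin q) :
    (designMeasure d q ρ R l μ).real (toothCell ρ J) = μ * (ρ / q) ^ d := by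
  have hsub : toothCell ρ J ⊆ designSet d q ρ R l := by
    refine Set.Subset.trans ?_ Set.subset_union_left
    rw [comb_prod_eq_iUnion]
    exact Set.subset_iUnion (fun J : Fin d → Fin q => toothCell ρ J) J
  rw [Measure.real, designMeasure_apply (measurableSet_toothCell J),
    Set.inter_eq_right.mpr hsub, toothCell, volume_prodSet fun _ => measurableSet_Icc]
  simp only [Real.volume_Icc]
  rw [Finset.prod_congr rfl fun i _ => show ENNReal.ofReal ((((J i : ℕ) : ℝ) + ρ) / q -
    ((J i : ℕ) : ℝ) / q) = ENNReal.ofReal (ρ / q) by congr 1; ring]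
  have : 0 ≤ ρ / q := by positivity
  simp [ENNReal.toReal_ofReal, hμ, this]

theorem volume_farCube : volume (farCube d R l) = ENNReal.ofReal l ^ d := by
  rw [farCube, volume_prodSet fun _ => measurableSet_Icc]
  simp

theorem designMeasure_real_farCube (hμ : 0 ≤ μ) (hl : 0 ≤ l) :
    (designMeasure d q ρ R l μ).real (farCube d R l) = μ * l ^ d := by
  have hsub : farCube d R l ⊆ designSet d q ρ R l := Set.subset_union_right
  rw [Measure.real, designMeasure_apply measurableSet_farCube,
    Set.inter_eq_right.mpr hsub, volume_farCube]
  simp [ENNReal.toReal_ofReal, hμ, hl]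

theorem disjoint_toothCell_farCube (hd : 0 < d) (hq : 0 < q) (hρ : ρ ≤ 1) (hR : 1 < R)
    (J : Fin d → Fin q) : Disjoint (toothCell ρ J) (farCube d R l) := by
  have hq' : (0 : ℝ) < q := by exact_mod_cast hq
  rw [Set.disjoint_left]
  intro x hx hx'
  have h1 := (hx ⟨0, hd⟩).2
  have h2 := (hx' ⟨0, hd⟩).1
  rw [le_div_iff₀ hq'] at h1
  have h3 : ((J ⟨0, hd⟩ : ℕ) : ℝ) + 1 ≤ q := by exact_mod_cast (J ⟨0, hd⟩).2
  nlinarith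

theorem disjoint_toothCell (hq : 0 < q) (hρ0 : 0 ≤ ρ) (hρ : d * ρ ≤ 1 / 4) {J K : Fin d → Fin q}
    (h : J ≠ K) : Disjoint (toothCell ρ J) (toothCell ρ K) := by
  rw [Set.disjoint_left]
  intro x hJ hK
  have h1 := norm_smul_sub_latticePt_le hq hρ0 hρ hJ
  have h2 := norm_smul_sub_latticePt_le hq hρ0 hρ hK
  exact h (latticePt_eq_of_norm_lt (x := (q : ℝ) • x) (by linarith) (by linarith))

theorem isProbabilityMeasure_designMeasure (hd : 0 < d) (hq : 0 < q) (hρ0 : 0 ≤ ρ) (hρ : ρ < 1)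
    (hR : 1 < R) (hl : 0 ≤ l) (hμ : 0 ≤ μ) (h1 : μ * ρ ^ d + μ * l ^ d = 1) :
    IsProbabilityMeasure (designMeasure d q ρ R l μ) := by
  constructor
  have hdisj : Disjoint (prodSet fun _ : Fin d => comb q ρ) (farCube d R l) := by
    rw [comb_prod_eq_iUnion, Set.disjoint_iUnion_left]
    exact fun J => disjoint_toothCell_farCube hd hq hρ.le hR J
  rw [designMeasure_apply MeasurableSet.univ, Set.inter_univ, designSet,
    measure_union hdisj measurableSet_farCube, volume_farCube,
    volume_prodSet fun _ => (isCompact_comb q ρ).measurableSet]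
  simp only [volume_comb hq hρ, Finset.prod_const, Finset.card_univ, Fintype.card_fin]
  rw [← ENNReal.ofReal_pow hρ0, ← ENNReal.ofReal_pow hl,
    ← ENNReal.ofReal_add (by positivity) (by positivity), ← ENNReal.ofReal_mul hμ, mul_add, h1,
    ENNReal.ofReal_one]

theorem strongDensity_designMeasure {c₀ r₀ μmax : ℝ} (hd : 0 < d) (hq : 0 < q) (hρ0 : 0 ≤ ρ)
    (hρ : ρ ≤ 1) (hc : c₀ ≤ (ρ / 4 / (2 * d)) ^ d) (hr : r₀ ≤ 1 / 2) (hrl : r₀ ≤ l)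
    (hμ : μ ≤ μmax) : StrongDensity c₀ r₀ μ μmax (designMeasure d q ρ R l μ) := by
  refine ⟨designSet d q ρ R l, isCompact_designSet, ?_,
    (designSet d q ρ R l).indicator fun _ => μ,
    measurable_const.indicator measurableSet_designSet, fun x hx => ?_, fun x hx => ?_, rfl⟩
  · refine IsRegularSet.union ?_ ?_
    · refine (isRegularSet_prodSet hd (fun _ => (isCompact_comb q ρ).measurableSet)
        (c := ρ / 4) (s₀ := 1 / 2) (by positivity) fun _ t ht s hs hs2 => ?_).mono hc hr
      exact ofReal_le_volume_comb_inter_Ioo hq hρ0 hρ ht hs hs2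
    -- The cube would allow a better constant; `ρ / 4` is used so that both pieces share one.
    · refine (isRegularSet_prodSet hd (fun _ => measurableSet_Icc)
        (c := ρ / 4) (s₀ := l) (by positivity) fun _ t ht s hs hsl => ?_).mono hc hrl
      refine ofReal_le_volume_Icc_inter_Ioo ht hs.le (by linarith) (by positivity) ?_
      nlinarith
  · rw [Set.indicator_of_mem hx]; exact ⟨le_rfl, hμ⟩
  · rw [Set.indicator_of_notMem hx]

/-- Integration of a function of the regression function against the design. -/
theorem integral_comp_regFun (hd : 0 < d) (hq : 0 < q) (hρ0 : 0 ≤ ρ) (hρ : d * ρ ≤ 1 / 4)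
    (hR : 4 * (d + 1) ≤ R) (hl : 0 ≤ l) (hμ : 0 ≤ μ)
    [IsProbabilityMeasure (designMeasure d q ρ R l μ)] (G : ℝ → ℝ) :
    ∫ x, G (regFun θ η₁ R b T a x) ∂(designMeasure d q ρ R l μ) =
      G θ + (G η₁ - G θ) * (μ * l ^ d) +
        ∑ J ∈ T, (G (θ + b * a J) - G θ) * (μ * (ρ / q) ^ d) := by
  classical
  have hd1 : (1 : ℝ) ≤ d := by exact_mod_cast hd
  have hρ1 : ρ ≤ 1 := by nlinarith
  have hR1 : 1 < R := by linarith
  -- On the support `η` is constant on each piece, so the composition is almost everywhere a simple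
  -- function and nothing is required of `G`.
  have hae : (fun x => G (regFun θ η₁ R b T a x)) =ᵐ[designMeasure d q ρ R l μ]
      fun x => G θ + (farCube d R l).indicator (fun _ => G η₁ - G θ) x +
        ∑ J ∈ T, (toothCell ρ J).indicator (fun _ => G (θ + b * a J) - G θ) x := by
    filter_upwards [ae_mem_designSet] with x hx
    rcases hx with hx | hx
    · rw [comb_prod_eq_iUnion] at hx
      obtain ⟨J, hJ⟩ := Set.mem_iUnion.mp hx
      rw [Set.indicator_of_notMem
        (Set.disjoint_left.mp (disjoint_toothCell_farCube hd hq hρ1 hR1 J) hJ)]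
      have hK : ∀ K, K ≠ J → x ∉ toothCell ρ K := fun K hK hxK =>
        Set.disjoint_left.mp (disjoint_toothCell hq hρ0 hρ hK) hxK hJ
      by_cases hJT : J ∈ T
      · rw [regFun_of_mem_toothCell hq hρ0 hρ hR hJ hJT, Finset.sum_eq_single J
          (fun K _ hKJ => Set.indicator_of_notMem (hK K hKJ) _) (fun h => absurd hJT h),
          Set.indicator_of_mem hJ]
        ring
      · rw [regFun_of_mem_toothCell_of_notMem hq hρ0 hρ hR hJ hJT, Finset.sum_eq_zero fun K hKT =>
          Set.indicator_of_notMem (hK K fun h => hJT (h ▸ hKT)) _]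
        ring
    · rw [regFun_of_mem_farCube hd hq hR hx, Set.indicator_of_mem hx, Finset.sum_eq_zero fun K _ =>
        Set.indicator_of_notMem (fun h => Set.disjoint_left.mp
          (disjoint_toothCell_farCube hd hq hρ1 hR1 K) h hx) _]
      ring
  have hi1 : ∀ c : ℝ, Integrable ((farCube d R l).indicator fun _ => c)
      (designMeasure d q ρ R l μ) := fun c => (integrable_const c).indicator measurableSet_farCube
  have hi2 : ∀ (J : Fin d → Fin q) (c : ℝ), Integrable ((toothCell ρ J).indicator fun _ => c)
      (designMeasure d q ρ R l μ) := fun J c =>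
    (integrable_const c).indicator (measurableSet_toothCell J)
  have hi3 : Integrable (fun x => G θ + (farCube d R l).indicator (fun _ => G η₁ - G θ) x)
      (designMeasure d q ρ R l μ) := (integrable_const _).add (hi1 _)
  rw [integral_congr_ae hae, integral_add hi3 (integrable_finsetSum _ fun J _ => hi2 J _),
    integral_add (integrable_const _) (hi1 _), integral_finsetSum _ fun J _ => hi2 J _,
    integral_indicator measurableSet_farCube, setIntegral_const, designMeasure_real_farCube hμ hl]
  congr 1
  · simp [mul_comm]
  · refine Finset.sum_congr rfl fun J _ => ?_
    rw [integral_indicator (measurableSet_toothCell J), setIntegral_const,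
      designMeasure_real_toothCell hμ hρ0, smul_eq_mul, mul_comm]

end Design

/-! ### Calibration of the threshold. -/

/-- The relative height of a bump: a raised bump has height `θ`, a lowered one `-(1 - θ)`, so that
the optimal threshold does not depend on which bumps are raised. -/
def bumpHeight (θ : ℝ) (s : Fin 2) : ℝ := if s = 1 then θ else -(1 - θ)

theorem abs_bumpHeight_le {θ : ℝ} (h0 : 0 ≤ θ) (h1 : θ ≤ 1) (s : Fin 2) :
    |bumpHeight θ s| ≤ 1 := by
  unfold bumpHeight
  split_ifs <;> rw [abs_le] <;> constructor <;> linarith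

/-- For `θ ≤ 1/2` the raised bump is the smaller one, so active cells stay at distance at least `b *
θ` from the threshold. -/
theorem le_abs_bumpHeight {θ : ℝ} (h1 : θ ≤ 1 / 2) (s : Fin 2) :
    θ ≤ |bumpHeight θ s| := by
  unfold bumpHeight
  split_ifs
  · exact le_abs_self _
  · rw [abs_neg]; exact le_trans (by linarith) (le_abs_self _)

/-- The value of the regression function on the far cube that makes `θ` the optimal threshold, when
the cube has mass `k` and `X` is the height of the bumps times the total mass of their cells. -/
def farValue (θ k X : ℝ) : ℝ := θ + (θ ^ 2 - θ * (1 - θ) * X) / ((1 - θ) * k)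

section FarValue

variable {κ θ X : ℝ}

theorem farValue_sub_mul (hκ1 : κ ≤ 1 / 4) (hκ0 : 0 ≤ κ) (hθ : θ = 1 / 2 - κ / 4) :
    (farValue θ (1 - κ) X - θ) * (1 - κ) * (1 - θ) = θ ^ 2 - θ * (1 - θ) * X := by
  have h1 : (1 - κ) ≠ 0 := by linarith
  have h2 : (1 - θ) ≠ 0 := by rw [hθ]; linarith
  rw [farValue, add_sub_cancel_left]
  field_simp

/-- The worst case is `X = 0`, where the claim is `θ ^ 2 ≤ (1 - θ) ^ 2 * (1 - κ)`. Placing `θ` at `κ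
/ 4` below `1/2` gives this with slack of first order in `κ`. -/
theorem farValue_le_one (hκ1 : κ ≤ 1 / 4) (hκ0 : 0 ≤ κ) (hθ : θ = 1 / 2 - κ / 4) (hX : 0 ≤ X) :
    farValue θ (1 - κ) X ≤ 1 := by
  have h1 : 0 < 1 - κ := by linarith
  have h2 : 0 < 1 - θ := by rw [hθ]; linarith
  have h3 : 0 ≤ θ * (1 - θ) * X := mul_nonneg (mul_nonneg (by linarith) h2.le) hX
  have h4 : θ ^ 2 ≤ (1 - θ) * ((1 - θ) * (1 - κ)) := by
    rw [hθ]
    nlinarith [mul_nonneg hκ0 (mul_nonneg hκ0 hκ0), mul_nonneg hκ0 hκ0]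
  have h5 : (θ ^ 2 - θ * (1 - θ) * X) / ((1 - θ) * (1 - κ)) ≤ 1 - θ := by
    rw [div_le_iff₀ (by positivity)]; linarith
  rw [farValue]; linarith

/-- Since `δ₀ ≤ 1/12`, this keeps the cube out of every margin band. -/
theorem lt_farValue_sub (hκ1 : κ ≤ 1 / 4) (hκ0 : 0 ≤ κ) (hθ : θ = 1 / 2 - κ / 4) (hX : 0 ≤ X)
    (hX1 : X ≤ κ / 8) : 1 / 12 < farValue θ (1 - κ) X - θ := by
  have h1 : 0 < 1 - κ := by linarith
  have h2 : 0 < 1 - θ := by rw [hθ]; linarith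
  rw [farValue, add_sub_cancel_left, lt_div_iff₀ (by positivity)]
  have h3 : θ * (1 - θ) * X ≤ 1 / 4 * (1 / 32) := by
    have : θ * (1 - θ) ≤ 1 / 4 := by nlinarith [sq_nonneg (θ - 1 / 2)]
    exact mul_le_mul this (by linarith) hX (by norm_num)
  have h4 : (7 / 16) ^ 2 ≤ θ ^ 2 := by
    apply pow_le_pow_left₀ <;> linarith
  have h5 : (1 - θ) * (1 - κ) ≤ 9 / 16 * 1 := by
    apply mul_le_mul <;> linarith
  nlinarith

/-- Used to bound `P(Y = 1)` from below; `-X` covers the worst joint contribution of the bumps. The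
point is `(1 - κ) * (1 - θ) ≤ θ`: `θ` is close enough to `1/2` to push `η` on the cube near 1. -/
theorem one_sub_le_theta_add (hκ1 : κ ≤ 1 / 4) (hκ0 : 0 ≤ κ) (hθ : θ = 1 / 2 - κ / 4) (hX : 0 ≤ X)
    (hX1 : X ≤ κ / 8) : 1 - 2 * κ ≤ θ + (farValue θ (1 - κ) X - θ) * (1 - κ) - X := by
  have h2 : 0 < 1 - θ := by rw [hθ]; linarith
  have h := farValue_sub_mul (X := X) hκ1 hκ0 hθ
  set y := (farValue θ (1 - κ) X - θ) * (1 - κ)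
  refine le_of_mul_le_mul_right ?_ h2
  have h6 : θ * (1 - θ) * X ≤ (1 - θ) * X := by
    have : θ * ((1 - θ) * X) ≤ 1 * ((1 - θ) * X) := by
      gcongr
      linarith
    linarith
  have h7 : (1 - θ) * X ≤ (1 - θ) * (κ / 8) := by gcongr
  have h8 : (1 - κ) * (1 - θ) ≤ θ := by rw [hθ]; nlinarith
  have h9 : (θ + y - X) * (1 - θ) = θ - θ * (1 - θ) * X - (1 - θ) * X := by
    linear_combination h
  rw [h9]
  nlinarith

end FarValue

/-! ### The lower bound for a fixed grid size. -/

set_option maxHeartbeats 1600000 in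
/-- One step of the construction: for every estimator, some distribution of the class built on a
comb with `q ^ d` cells has a large expected excess score. -/
theorem exists_mem_classPSigma_le_expectedExcess {d q n N : ℕ}
    {α C₀ δ₀ p β L c₀ r₀ μ μmax ρ R l L₀ b κ θ w : ℝ} (hα : 0 < α) (hC₀ : 0 < C₀)
    (hδ₀ : δ₀ ≤ 1 / 12) (hd : 0 < d) (hq : 0 < q) (hp : 0 < p)
    (hρ0 : 0 < ρ) (hρ : d * ρ ≤ 1 / 4) (hR : 4 * (d + 1) ≤ R) (hl : 0 < l) (hμ : 0 < μ)
    (hμmax : μ ≤ μmax) (hκ : κ = μ * ρ ^ d) (hκl : μ * l ^ d = 1 - κ) (hκ1 : κ ≤ 1 / 4)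
    (hκp : p ≤ 1 - 2 * κ) (hθ : θ = 1 / 2 - κ / 4) (hb : 0 < b) (hb1 : b ≤ 1 / 8)
    (hw : w = μ * (ρ / q) ^ d) (T : Finset (Fin d → Fin q)) (hTκ : T.card * w ≤ κ)
    (hTα : T.card * w ≤ C₀ * (b * θ) ^ α) (hL₀ : 0 ≤ L₀) (hL1 : HasTaylorBound β L₀ (unitBump d))
    (hL2 : ∀ a : (Fin d → Fin q) → ℝ, (∀ J, |a J| ≤ 1) → HasTaylorBound β L₀ (bumpSum T a))
    (hRL : L₀ * R⁻¹ ^ β ≤ L / 2) (hbL : b * (L₀ * (q : ℝ) ^ β) ≤ L / 2)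
    (hc : c₀ ≤ (ρ / 4 / (2 * d)) ^ d) (hr : r₀ ≤ 1 / 2) (hrl : r₀ ≤ l)
    (hn : (1 + 16 * b ^ 2 * w) ^ n ≤ 5 / 4) (g : ClassifierEstimator d n N) :
    ∃ P ∈ classPSigma d α C₀ δ₀ p β L c₀ r₀ μ μmax,
      b * θ / 2 * (T.card * (w / 4)) ≤ expectedExcess 1 P g := by
  classical
  have hd1 : (1 : ℝ) ≤ d := by exact_mod_cast hd
  have hρ1 : ρ ≤ 1 / 4 := by nlinarith
  have hκ0 : 0 ≤ κ := by rw [hκ]; positivity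
  have hw0 : 0 ≤ w := by rw [hw]; positivity
  set Q := designMeasure d q ρ R l μ with hQ
  have hQp : IsProbabilityMeasure Q := isProbabilityMeasure_designMeasure hd hq hρ0.le
    (by linarith) (by linarith) hl.le hμ.le (by rw [hκl, hκ]; ring)
  set X := T.card * (b * w) with hX
  have hX0 : 0 ≤ X := by positivity
  have hX1 : X ≤ κ / 8 := by
    calc X = b * (T.card * w) := by ring
      _ ≤ 1 / 8 * κ := by gcongr
      _ = κ / 8 := by ring
  set η₁ := farValue θ (1 - κ) X with hη₁
  have hgap := lt_farValue_sub hκ1 hκ0 hθ hX0 hX1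
  rw [← hη₁] at hgap
  have hη01 : η₁ ∈ Set.Icc (0 : ℝ) 1 := ⟨by linarith, farValue_le_one hκ1 hκ0 hθ hX0⟩
  have hθ0 : 0 < θ := by linarith
  set ht : ((Fin d → Fin q) → Fin 2) → (Fin d → Fin q) → ℝ := fun σ J => bumpHeight θ (σ J) with hht
  have hht1 : ∀ σ J, |ht σ J| ≤ 1 := fun σ J => abs_bumpHeight_le hθ0.le (by linarith) _
  set η : ((Fin d → Fin q) → Fin 2) → Feat d → ℝ := fun σ => regFun θ η₁ R b T (ht σ) with hη
  have hηm : ∀ σ, Measurable (η σ) := fun σ => continuous_regFun.measurable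
  have hη01' : ∀ σ x, η σ x ∈ Set.Icc (0 : ℝ) 1 := fun σ =>
    regFun_mem_Icc hq hR hb.le (by linarith) (by linarith) hη01 (hht1 σ)
  have hint : ∀ σ (G : ℝ → ℝ), ∫ x, G (η σ x) ∂Q =
      G θ + (G η₁ - G θ) * (1 - κ) + ∑ J ∈ T, (G (θ + b * ht σ J) - G θ) * w := by
    intro σ G
    rw [hw, ← hκl]
    exact integral_comp_regFun hd hq hρ0.le hρ hR hl.le hμ.le G
  have hπ : ∀ σ, ∫ x, η σ x ∂Q = θ + (η₁ - θ) * (1 - κ) + ∑ J ∈ T, ht σ J * (b * w) := by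
    intro σ
    refine (hint σ id).trans ?_
    simp only [id]
    congr 1
    exact Finset.sum_congr rfl fun J _ => by ring
  have hπp : ∀ σ, p ≤ ∫ x, η σ x ∂Q := by
    intro σ
    rw [hπ σ]
    have h1 : -X ≤ ∑ J ∈ T, ht σ J * (b * w) := by
      have : ∑ _J ∈ T, -(b * w) ≤ ∑ J ∈ T, ht σ J * (b * w) := Finset.sum_le_sum fun J _ => by
        have h2 := (abs_le.mp (hht1 σ J)).1
        have h3 : 0 ≤ b * w := by positivity
        nlinarith
      simpa [hX] using this
    have h2 := one_sub_le_theta_add hκ1 hκ0 hθ hX0 hX1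
    rw [← hη₁] at h2
    linarith
  have hthr : ∀ σ, θ * ∫ x, η σ x ∂Q = ∫ x, max (η σ x - θ) 0 ∂Q := by
    intro σ
    rw [hπ σ, hint σ fun y => max (y - θ) 0]
    have h1 : max (η₁ - θ) 0 = η₁ - θ := max_eq_left (by linarith)
    -- Bit independence: raised or lowered, a bump contributes to `E (η - θ)₊` exactly `θ * (1 - θ)
    -- * b * w` more than `θ` times its contribution to `E η`.
    have h2 : ∑ J ∈ T, (max (θ + b * ht σ J - θ) 0 - max (θ - θ) 0) * w =
        θ * ∑ J ∈ T, ht σ J * (b * w) + θ * (1 - θ) * X := by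
      rw [hX, ← nsmul_eq_mul, ← Finset.sum_const, Finset.mul_sum, Finset.mul_sum,
        ← Finset.sum_add_distrib]
      refine Finset.sum_congr rfl fun J _ => ?_
      simp only [hht, bumpHeight, sub_self, max_self, add_sub_cancel_left, sub_zero]
      split_ifs
      · rw [max_eq_left (by positivity)]; ring
      · rw [max_eq_right (by nlinarith)]; ring
    rw [h1, h2]
    have h3 := farValue_sub_mul (X := X) hκ1 hκ0 hθ
    rw [← hη₁] at h3
    simp only [sub_self, max_self, sub_zero, zero_add]
    linear_combination -h3
  have hmem : ∀ σ, regMeasure Q (η σ) ∈ classPSigma d α C₀ δ₀ p β L c₀ r₀ μ μmax := by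
    intro σ
    refine ⟨isProbabilityMeasure_regMeasure (hηm σ) (hη01' σ), ?_, ?_, η σ,
      isRegressionFunction_regMeasure (hηm σ) (hη01' σ), ?_, θ, ⟨⟨hθ0.le, by linarith⟩, ?_⟩, ?_⟩
    · rw [probOne_regMeasure (hηm σ) (hη01' σ)]
      exact hπp σ
    · rw [regMeasure_fst (hηm σ) (hη01' σ)]
      exact strongDensity_designMeasure hd hq hρ0.le (by linarith) hc hr hrl hμmax
    · exact isHolder_regFun hq hR hb.le (by linarith) (by linarith) hη01 (hht1 σ) hL₀ hL1
        (hL2 _ (hht1 σ)) hRL hbL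
    · rw [probOne_regMeasure (hηm σ) (hη01' σ), regMeasure_fst (hηm σ) (hη01' σ), ← hthr σ]
      ring
    · intro δ hδ0 hδ
      rw [regMeasure_fst (hηm σ) (hη01' σ)]
      set G : ℝ → ℝ := {y : ℝ | 0 < |y - θ| ∧ |y - θ| ≤ δ}.indicator 1 with hG
      have hGle : ∀ y, G y ≤ 1 := fun y => Set.indicator_le_self' (fun _ _ => zero_le_one) y
      have hGθ : G θ = 0 := Set.indicator_of_notMem (fun h => by simpa using h.1) _
      have hGη₁ : G η₁ = 0 := Set.indicator_of_notMem (fun h => by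
        have := (le_abs_self _).trans h.2
        linarith) _
      have hms : MeasurableSet {x | 0 < |η σ x - θ| ∧ |η σ x - θ| ≤ δ} := by
        have habs : Measurable fun x => |η σ x - θ| :=
          (continuous_regFun.sub continuous_const).abs.measurable
        exact (measurableSet_lt measurable_const habs).inter (measurableSet_le habs measurable_const)
      have hreal : Q.real {x | 0 < |η σ x - θ| ∧ |η σ x - θ| ≤ δ} =
          ∑ J ∈ T, G (θ + b * ht σ J) * w := by
        rw [← integral_indicator_one hms]
        refine (hint σ G).trans ?_
        rw [hGθ, hGη₁]
        simp
      rw [hreal]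
      -- Below `b * θ` the band carries no mass; from there up to `δ₀` it carries at most the mass
      -- of all active cells.
      rcases lt_or_ge δ (b * θ) with hlt | hge
      · rw [Finset.sum_eq_zero fun J _ => ?_]
        · positivity
        · rw [hG, Set.indicator_of_notMem, zero_mul]
          intro h
          have h1 := h.2
          rw [add_sub_cancel_left, abs_mul, abs_of_pos hb] at h1
          have h2 : θ ≤ |ht σ J| := le_abs_bumpHeight (by linarith) (σ J)
          have h3 : b * θ ≤ b * |ht σ J| := by gcongr
          linarith
      · calc ∑ J ∈ T, G (θ + b * ht σ J) * w ≤ ∑ _J ∈ T, 1 * w := by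
              gcongr; exact hGle _
          _ = T.card * w := by simp
          _ ≤ C₀ * (b * θ) ^ α := hTα
          _ ≤ C₀ * δ ^ α := by gcongr
  have hval : ∀ σ, ∀ J ∈ T, ∀ x ∈ toothCell ρ J, η σ x = θ + b * bumpHeight θ (σ J) :=
    fun σ J hJ x hx => regFun_of_mem_toothCell hq hρ0.le hρ hR hx hJ
  have hbh : ∀ s, |b * bumpHeight θ s| ≤ b := fun s => by
    rw [abs_mul, abs_of_pos hb]
    exact mul_le_of_le_one_right hb.le (abs_bumpHeight_le hθ0.le (by linarith) s)
  obtain ⟨σ, hσ⟩ := exists_le_expectedExcess (Q := Q) g hηm hη01' (θ := θ)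
    (fun σ => hp.trans_le (hπp σ)) hthr T (toothCell ρ)
    (fun J _ => measurableSet_toothCell J) (fun J _ K _ h => disjoint_toothCell hq hρ0.le hρ h)
    (w := w) (fun J _ => by rw [hw]; exact designMeasure_real_toothCell hμ.le hρ0.le J)
    (h := b * θ) (Δ := b) (by positivity)
    (fun σ J hJ hs x hx => by rw [hval σ J hJ x hx, bumpHeight, if_pos hs]; linarith)
    (fun σ J hJ hs x hx => by rw [hval σ J hJ x hx, bumpHeight, if_neg hs]; nlinarith)
    -- Equality holds only almost everywhere: the bump of `J` spills into the gap around its cell,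
    -- which has no mass.
    (fun σ σ' J hJ hs => by
      filter_upwards [ae_mem_designSet] with x hx hxJ
      rcases hx with hx | hx
      · rw [comb_prod_eq_iUnion] at hx
        obtain ⟨K, hK⟩ := Set.mem_iUnion.mp hx
        by_cases hKT : K ∈ T
        · have hKJ : K ≠ J := fun h => hxJ (h ▸ hK)
          rw [hval σ K hKT x hK, hval σ' K hKT x hK, hs K hKJ]
        · exact (regFun_of_mem_toothCell_of_notMem hq hρ0.le hρ hR hK hKT).trans
            (regFun_of_mem_toothCell_of_notMem hq hρ0.le hρ hR hK hKT).symm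
      · exact (regFun_of_mem_farCube hd hq hR hx).trans (regFun_of_mem_farCube hd hq hR hx).symm)
    (fun σ J hJ x hx => by
      rw [hval σ J hJ x hx]; linarith [(abs_le.mp (hbh (σ J))).1])
    (fun σ J hJ x hx => by
      rw [hval σ J hJ x hx]; linarith [(abs_le.mp (hbh (σ J))).2])
    (fun σ σ' J hJ x hx => by
      rw [hval σ J hJ x hx, hval σ' J hJ x hx, add_sub_add_left_eq_sub, ← mul_sub, abs_mul,
        abs_of_pos hb]
      refine mul_le_of_le_one_right hb.le ?_
      unfold bumpHeight
      split_ifs <;> rw [abs_le] <;> constructor <;> linarith) hn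
  exact ⟨_, hmem σ, hσ⟩

/-! ### Choice of the parameters and the rate. -/

theorem one_add_pow_le_five_fourths {x : ℝ} (hx : 0 ≤ x) {n : ℕ} (h : n * x ≤ 1 / 8) :
    (1 + x) ^ n ≤ 5 / 4 := by
  have h1 : (1 + x) ^ n ≤ Real.exp (n * x) := by
    rw [Real.exp_nat_mul]
    exact pow_le_pow_left₀ (by linarith) (by linarith [Real.add_one_le_exp x]) n
  have h2 : Real.exp (n * x) ≤ Real.exp (1 / 8) := Real.exp_le_exp.mpr h
  have h3 : 1 - 1 / 8 ≤ Real.exp (-(1 / 8)) := by linarith [Real.add_one_le_exp (-(1 / 8) : ℝ)]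
  have h4 : Real.exp (1 / 8) * Real.exp (-(1 / 8)) = 1 := by rw [← Real.exp_add]; simp
  nlinarith [Real.exp_pos (1 / 8)]

/-- The number of cells per side matched to the sample size. -/
theorem exists_gridSize {n : ℕ} (hn : 1 < n) {t : ℝ} (ht : 0 < t) :
    ∃ q : ℕ, 0 < q ∧ (n : ℝ) ≤ (q : ℝ) ^ t ∧ (q : ℝ) ≤ 2 * (n : ℝ) ^ t⁻¹ := by
  have hn1 : (1 : ℝ) ≤ n := by exact_mod_cast hn.le
  have h1 : (1 : ℝ) ≤ (n : ℝ) ^ t⁻¹ := Real.one_le_rpow hn1 (by positivity)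
  refine ⟨⌈(n : ℝ) ^ t⁻¹⌉₊, Nat.ceil_pos.mpr (by linarith), ?_, ?_⟩
  · calc (n : ℝ) = ((n : ℝ) ^ t⁻¹) ^ t := by
          rw [← Real.rpow_mul (by positivity), inv_mul_cancel₀ ht.ne', Real.rpow_one]
      _ ≤ _ := by gcongr; exact Nat.le_ceil _
  · linarith [Nat.ceil_lt_add_one (a := (n : ℝ) ^ t⁻¹) (by positivity)]

/-- Rounding down loses at most half because `q ^ s ≥ 1`; this is where `s ≥ 0`, that is `α * β ≤
d`, matters. -/
theorem exists_finset_card_cells {d q : ℕ} (hq : 0 < q) {s : ℝ} (hs0 : 0 ≤ s) (hs : s ≤ d) :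
    ∃ T : Finset (Fin d → Fin q), (T.card : ℝ) ≤ (q : ℝ) ^ s ∧ (q : ℝ) ^ s / 2 ≤ T.card := by
  have hq1 : (1 : ℝ) ≤ q := by exact_mod_cast hq
  have h1 : (1 : ℝ) ≤ (q : ℝ) ^ s := Real.one_le_rpow hq1 hs0
  have h2 : (q : ℝ) ^ s ≤ (q : ℝ) ^ d := by
    rw [← Real.rpow_natCast]
    exact Real.rpow_le_rpow_of_exponent_le hq1 hs
  have h3 : (⌊(q : ℝ) ^ s⌋₊ : ℝ) ≤ (q : ℝ) ^ s := Nat.floor_le (by positivity)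
  have h4 : ⌊(q : ℝ) ^ s⌋₊ ≤ (Finset.univ : Finset (Fin d → Fin q)).card := by
    rw [Finset.card_univ, Fintype.card_fun, Fintype.card_fin, Fintype.card_fin]
    exact_mod_cast h3.trans h2
  obtain ⟨T, _, hT⟩ := Finset.exists_subset_card_eq h4
  refine ⟨T, by rw [hT]; exact h3, ?_⟩
  rw [hT]
  have h5 := Nat.lt_floor_add_one ((q : ℝ) ^ s)
  have h6 : (1 : ℝ) ≤ ⌊(q : ℝ) ^ s⌋₊ := by exact_mod_cast Nat.le_floor (by exact_mod_cast h1)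
  linarith

set_option maxHeartbeats 1000000 in
theorem mainTheorem5 (d : ℕ) (α β p C₀ δ₀ L μmin μmax : ℝ)
    (hα : 0 < α) (hβ : 0 < β) (hαβ : α * β ≤ d)
    (hp : 0 < p) (hp1 : p < 1) (hC₀ : 0 < C₀) (hδ₀ : 0 < δ₀) (hδ₀' : δ₀ ≤ 1 / 12)
    (hL : 0 < L) (hμmin : 0 < μmin) (hμ : μmin ≤ μmax) :
    ∃ cbar : ℝ, 0 < cbar ∧ ∃ rbar : ℝ, 0 < rbar ∧
      ∀ c₀ r₀ : ℝ, 0 < c₀ → c₀ ≤ cbar → 0 < r₀ → r₀ ≤ rbar →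
        ∃ c : ℝ, 0 < c ∧ ∀ n N : ℕ, 1 < n → 1 < N →
          ((c * (n : ℝ) ^ (-((1 + α) * β / (2 * β + d))) : ℝ) : EReal) ≤
            minimaxExcess 1 n N (classPSigma d α C₀ δ₀ p β L c₀ r₀ μmin μmax) := by
  have hdR : (0 : ℝ) < d := (mul_pos hα hβ).trans_le hαβ
  have hd : 0 < d := by exact_mod_cast hdR
  have hd1 : (1 : ℝ) ≤ d := by exact_mod_cast hd
  obtain ⟨L₀, hL₀, hL1, hL2⟩ := exists_hasTaylorBound_bumpSum d hβ.le
  obtain ⟨cB, hcB, hcB1, hcBL⟩ : ∃ cB : ℝ, 0 < cB ∧ cB ≤ 1 / 8 ∧ cB * L₀ ≤ L / 2 :=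
    ⟨min (1 / 8) (L / 2 / L₀), by positivity, min_le_left _ _,
      (le_div_iff₀ hL₀).mp (min_le_right _ _)⟩
  -- The three bounds on the comb mass serve the calibration of `θ`, the condition `P(Y = 1) ≥ p`
  -- and the margin constant; `7 / 16` is the least possible `θ` when `κ ≤ 1/4`.
  obtain ⟨κ₀, hκ₀, hκ₀1, hκ₀p, hκ₀C⟩ : ∃ κ₀ : ℝ, 0 < κ₀ ∧ κ₀ ≤ 1 / 4 ∧ κ₀ ≤ (1 - p) / 2 ∧
      κ₀ ≤ C₀ * (cB * (7 / 16)) ^ α :=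
    ⟨min (1 / 4) (min ((1 - p) / 2) (C₀ * (cB * (7 / 16)) ^ α)),
      lt_min (by norm_num) (lt_min (by linarith) (by positivity)), min_le_left _ _,
      (min_le_right _ _).trans (min_le_left _ _), (min_le_right _ _).trans (min_le_right _ _)⟩
  obtain ⟨ρ, hρ0, hρ, hρκ⟩ : ∃ ρ : ℝ, 0 < ρ ∧ d * ρ ≤ 1 / 4 ∧ μmin * ρ ≤ κ₀ := by
    refine ⟨min (1 / 4 / d) (κ₀ / μmin), by positivity, ?_, ?_⟩
    · rw [mul_comm]; exact (le_div_iff₀ hdR).mp (min_le_left _ _)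
    · rw [mul_comm]; exact (le_div_iff₀ hμmin).mp (min_le_right _ _)
  have hρ1 : ρ ≤ 1 := by nlinarith
  set κ := μmin * ρ ^ d with hκ
  have hκ0 : 0 < κ := by positivity
  have hκκ₀ : κ ≤ κ₀ := by
    refine le_trans ?_ hρκ
    rw [hκ]
    gcongr
    exact pow_le_of_le_one hρ0.le hρ1 hd.ne'
  obtain ⟨l, hl, hlκ⟩ : ∃ l : ℝ, 0 < l ∧ μmin * l ^ d = 1 - κ := by
    have h1 : 0 < (1 - κ) / μmin := div_pos (by linarith) hμmin
    refine ⟨((1 - κ) / μmin) ^ (d : ℝ)⁻¹, by positivity, ?_⟩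
    rw [Real.rpow_inv_natCast_pow h1.le hd.ne']
    field_simp
  obtain ⟨R, hR, hRL⟩ : ∃ R : ℝ, 4 * (d + 1) ≤ R ∧ L₀ * R⁻¹ ^ β ≤ L / 2 := by
    refine ⟨max (4 * (d + 1)) ((2 * L₀ / L) ^ β⁻¹), le_max_left _ _, ?_⟩
    set R := max (4 * ((d : ℝ) + 1)) ((2 * L₀ / L) ^ β⁻¹)
    have hR0 : 0 < R := lt_max_of_lt_left (by positivity)
    have h1 : 2 * L₀ / L ≤ R ^ β := by
      calc 2 * L₀ / L = ((2 * L₀ / L) ^ β⁻¹) ^ β := by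
            rw [← Real.rpow_mul (by positivity), inv_mul_cancel₀ hβ.ne', Real.rpow_one]
        _ ≤ R ^ β := by gcongr; exact le_max_right _ _
    rw [Real.inv_rpow hR0.le, mul_inv_le_iff₀ (by positivity)]
    rw [div_le_iff₀ hL] at h1
    linarith
  refine ⟨(ρ / 4 / (2 * d)) ^ d, by positivity, min (1 / 2) l, by positivity,
    fun c₀ r₀ _ hc _ hr => ?_⟩
  set θ := 1 / 2 - κ / 4 with hθ
  have hθ1 : 7 / 16 ≤ θ := by linarith
  -- The factor 64 collects `θ ≥ 1/4`, the halves from the excess score and from rounding the number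
  -- of cells, and the `1/4` of Assouad's lemma; the power of 2 comes from rounding `q` up.
  refine ⟨cB * κ / 64 * (2 : ℝ) ^ (-((1 + α) * β)), by positivity, fun n N hn _ => ?_⟩
  have hn0 : (0 : ℝ) < n := by exact_mod_cast (by omega : 0 < n)
  obtain ⟨q, hq, hnq, hqn⟩ := exists_gridSize hn (t := 2 * β + d) (by positivity)
  have hq0 : (0 : ℝ) < q := by exact_mod_cast hq
  have hq1 : (1 : ℝ) ≤ q := by exact_mod_cast hq
  obtain ⟨T, hT1, hT2⟩ := exists_finset_card_cells (d := d) hq (s := d - α * β) (by linarith)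
    (by nlinarith)
  set b := cB * (q : ℝ) ^ (-β) with hb
  set w := μmin * (ρ / q) ^ d with hw
  have hwκ : w = κ * (q : ℝ) ^ (-(d : ℝ)) := by
    rw [hw, hκ, div_pow, Real.rpow_neg hq0.le, Real.rpow_natCast]
    field_simp
  have hb0 : 0 < b := by positivity
  have hqβ : (q : ℝ) ^ (-β) ≤ 1 := Real.rpow_le_one_of_one_le_of_nonpos hq1 (by linarith)
  have hb1 : b ≤ 1 / 8 := (mul_le_of_le_one_right hcB.le hqβ).trans hcB1
  have hTw : T.card * w ≤ κ * (q : ℝ) ^ (-(α * β)) := by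
    calc T.card * w ≤ (q : ℝ) ^ (d - α * β) * (κ * (q : ℝ) ^ (-(d : ℝ))) := by rw [hwκ]; gcongr
      _ = κ * ((q : ℝ) ^ (d - α * β) * (q : ℝ) ^ (-(d : ℝ))) := by ring
      _ = κ * (q : ℝ) ^ (-(α * β)) := by rw [← Real.rpow_add hq0]; congr 2; ring
  have hTκ : T.card * w ≤ κ := hTw.trans (mul_le_of_le_one_right hκ0.le
    (Real.rpow_le_one_of_one_le_of_nonpos hq1 (by nlinarith)))
  have hTα : T.card * w ≤ C₀ * (b * θ) ^ α := by
    calc T.card * w ≤ κ * (q : ℝ) ^ (-(α * β)) := hTw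
      _ ≤ C₀ * (cB * (7 / 16)) ^ α * (q : ℝ) ^ (-(α * β)) := by
          gcongr; exact hκκ₀.trans hκ₀C
      _ = C₀ * (cB * (q : ℝ) ^ (-β) * (7 / 16)) ^ α := by
          rw [show cB * (q : ℝ) ^ (-β) * (7 / 16) = cB * (7 / 16) * (q : ℝ) ^ (-β) by ring,
            Real.mul_rpow (by positivity) (by positivity) (y := (q : ℝ) ^ (-β)),
            ← Real.rpow_mul hq0.le, mul_assoc]
          congr 3; ring
      _ ≤ C₀ * (b * θ) ^ α := by gcongr
  have hbL : b * (L₀ * (q : ℝ) ^ β) ≤ L / 2 := by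
    have : b * (L₀ * (q : ℝ) ^ β) = cB * L₀ * ((q : ℝ) ^ (-β) * (q : ℝ) ^ β) := by rw [hb]; ring
    rw [this, ← Real.rpow_add hq0, neg_add_cancel, Real.rpow_zero, mul_one]
    exact hcBL
  have hchi : (1 + 16 * b ^ 2 * w) ^ n ≤ 5 / 4 := by
    refine one_add_pow_le_five_fourths (by positivity) ?_
    -- The grid size was chosen for this: `n ≤ q ^ (2 * β + d)` cancels `b ^ 2 * w` exactly, leaving
    -- a constant.
    have h1 : (n : ℝ) * (b ^ 2 * w) ≤ cB ^ 2 * κ := by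
      calc (n : ℝ) * (b ^ 2 * w) ≤ (q : ℝ) ^ (2 * β + d) * (b ^ 2 * w) := by gcongr
        _ = cB ^ 2 * κ * ((q : ℝ) ^ (2 * β + d) * ((q : ℝ) ^ (-β) * (q : ℝ) ^ (-β)) *
            (q : ℝ) ^ (-(d : ℝ))) := by rw [hb, hwκ]; ring
        _ = cB ^ 2 * κ := by
            rw [← Real.rpow_add hq0, ← Real.rpow_add hq0, ← Real.rpow_add hq0]
            rw [show 2 * β + d + (-β + -β) + -(d : ℝ) = 0 by ring, Real.rpow_zero, mul_one]
    have h2 : cB ^ 2 * κ ≤ (1 / 8) ^ 2 * (1 / 4) := by gcongr; linarith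
    linarith
  unfold minimaxExcess
  refine le_iInf fun g => ?_
  obtain ⟨P, hP, hPle⟩ := exists_mem_classPSigma_le_expectedExcess (N := N) hα hC₀ hδ₀' hd hq hp hρ0
    hρ hR hl hμmin hμ hκ hlκ (hκκ₀.trans hκ₀1) (by linarith) hθ hb0 hb1 hw T hTκ hTα hL₀.le hL1
    (hL2 q T) hRL hbL hc (hr.trans (min_le_left _ _)) (hr.trans (min_le_right _ _)) hchi g
  refine le_trans (EReal.coe_le_coe_iff.mpr (le_trans ?_ hPle)) (le_iSup₂_of_le P hP le_rfl)
  have hrate : (2 : ℝ) ^ (-((1 + α) * β)) * (n : ℝ) ^ (-((1 + α) * β / (2 * β + d))) ≤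
      (q : ℝ) ^ (-((1 + α) * β)) := by
    calc _ = (2 * (n : ℝ) ^ (2 * β + d : ℝ)⁻¹) ^ (-((1 + α) * β)) := by
          rw [Real.mul_rpow (by norm_num) (by positivity), ← Real.rpow_mul hn0.le]
          congr 2
          rw [div_eq_inv_mul]; ring
      _ ≤ _ := Real.rpow_le_rpow_of_nonpos hq0 hqn (by
          have : 0 < (1 + α) * β := by positivity
          linarith)
  calc _ = cB * κ / 64 * ((2 : ℝ) ^ (-((1 + α) * β)) *
        (n : ℝ) ^ (-((1 + α) * β / (2 * β + d)))) := by ring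
    _ ≤ cB * κ / 64 * (q : ℝ) ^ (-((1 + α) * β)) := by gcongr
    _ = cB * (q : ℝ) ^ (-β) * (1 / 4) / 2 *
        ((q : ℝ) ^ (d - α * β) / 2 * (κ * (q : ℝ) ^ (-(d : ℝ)) / 4)) := by
        have : (q : ℝ) ^ (-((1 + α) * β)) =
            (q : ℝ) ^ (-β) * (q : ℝ) ^ (d - α * β) * (q : ℝ) ^ (-(d : ℝ)) := by
          rw [← Real.rpow_add hq0, ← Real.rpow_add hq0]; congr 1; ring
        rw [this]; ring
    _ ≤ b * θ / 2 * (T.card * (w / 4)) := by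
        rw [hwκ]
        have h1 : b * (1 / 4) / 2 ≤ b * θ / 2 := by
          have : b * (1 / 4) ≤ b * θ := mul_le_mul_of_nonneg_left (by linarith) hb0.le
          linarith
        exact mul_le_mul h1 (mul_le_mul_of_nonneg_right hT2 (by positivity)) (by positivity)
          (by positivity)

end
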